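/- **Definitions.** A *net* $N=(S,T,F,M_0)$ consists of disjoint sets $S$ (places) and $T$ (transitions), arc weights $F:(S\times T)\cup(T\times S)\to\mathbb N$ and an initial marking $M_0:S\to\mathbb N$, such that every $t\in T$ has finitely many and at least one preplace ($F(s,t)>0$) and finitely many postplaces ($F(t,s)>0$). It is *countable* if $S$ and $T$ are countable. For a multiset $G$ of transitions, ${}^\bullet G(s)=\sum_t G(t)F(s,t)$ and $G^\bullet(s)=\sum_t G(t)F(t,s)$. A finite non-empty multiset $G$ of transitions *can fire* in a marking $M\in\mathbb N^S$ if ${}^\bullet G\le M$, and then leads to $(M-{}^\bullet G)+G^\bullet$. A marking is *reachable* if it is obtained from $M_0$ by firing finitely many single transitions successively. $N$ is *binary-conflict-free* if there are no reachable marking $M$ and multiset $G$ of transitions with $|G|=2$ such that for each $t\in G$ the restriction of $G$ to $\{t\}$ can fire in $M$ but $G$ cannot. A *process* of $N$ is a pair $P=(\mathcal N,\pi)$ of a net $\mathcal N=(\mathcal S,\mathcal T,\mathcal F,\mathcal M_0)$ and a map $\pi$ sending $\mathcal S$ to $S$ and $\mathcal T$ to $T$, such that: every $s\in\mathcal S$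 satisfies $\sum_t\mathcal F(t,s)\le1$ and $\sum_t\mathcal F(s,t)\le 1$, and $\mathcal M_0(s)$ is $1$ if $s$ has no incoming arc and $0$ otherwise; the transitive closure $\mathcal F^+$ of $\{(x,y)\mid \mathcal F(x,y)>0\}$ is irreflexive; each transition has finitely many $\mathcal F^+$-predecessors among the transitions; and for all $s\in S$, $t\in\mathcal T$ one has $M_0(s)=\sum_{x\in\pi^{-1}(s)}\mathcal M_0(x)$, $F(s,\pi(t))=\sum_{x\in\pi^{-1}(s)}\mathcal F(x,t)$ and $F(\pi(t),s)=\sum_{x\in\pi^{-1}(s)}\mathcal F(t,x)$. It is *finite* if $\mathcal T$ is finite. A process $P'$ is a *prefix* of $P$, $P'\le P$, if $\mathcal S'\subseteq\mathcal S$, $\mathcal T'\subseteq\mathcal T$, $\mathcal M_0'=\mathcal M_0$ (as multisets), and $\mathcal F'$, $\pi'$ are the restrictions of $\mathcal F$, $\pi$. If $p,q\in\mathcal S$ are unrelated by $\mathcal F^+$ and $\pi(p)=\pi(q)$, then $\mathrm{swap}(P,p,q)$ is obtained from $P$ by exchanging the outgoing arcs of $p$ and $q$. Let $\approx_s^*$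 be the reflexive and transitive closure of the relation "$\mathrm{swap}(P,p,q)$ is isomorphic to $Q$ for some such $p,q$" on processes of $N$ (isomorphic processes being identified), and write $[P]$ for the $\approx_s^*$-class of a finite process $P$. Put $[P']\le[P]$ iff $P'\approx_s^* Q'\le Q\approx_s^* P$ for some $Q',Q$. A *BD-run* of $N$ is a non-empty set of such classes $[P]$ that is closed downwards and directed with respect to $\le$. For a process $P$, let $BD(P)$ be the downward closure under $\le$ of $\{[P']\mid P'\le P,\ P'\text{ finite}\}$. Two processes $P,Q$ are *swapping equivalent* if $BD(P)=BD(Q)$, and a *BD-process* of $N$ is an equivalence class for this relation. The BD-process of $P$ is *run-maximal* if $BD(P)$ is maximal with respect to inclusion among all BD-runs of $N$. **Lemma.** Let $N$ be a binary-conflict-free net. 1. $N$ has at most one run-maximal BD-process. 2. If, moreover, $N$ is countable, then $N$ has exactly one run-maximal BD-process. -/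

import Mathlib

universe u

/-- The cardinality `|A| = ∑ x, A x` (possibly infinite) of a multiset `A : X → ℕ`: the number of
its elements, counted with multiplicity. -/
noncomputable def mcard {X : Type u} (A : X → ℕ) : ℕ∞ :=
  ENat.card (Σ x : X, Fin (A x))

/-- A net (place/transition system) with places `S`, transitions `T`, and arc weights
`F(s,t) = arcST s t` and `F(t,s) = arcTS t s`. -/
structure Net : Type (u + 1) where
  S : Type u
  T : Type u
  arcST : S → T → ℕ
  arcTS : T → S → ℕ
  M₀ : S → ℕ
  finite_preplaces : ∀ t, {s | 0 < arcST s t}.Finite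
  nonempty_preplaces : ∀ t, {s | 0 < arcST s t}.Nonempty
  finite_postplaces : ∀ t, {s | 0 < arcTS t s}.Finite

namespace Net

/-- The multiset of preplaces of a finite multiset of transitions. -/
def pre (N : Net.{u}) (G : Multiset N.T) : N.S → ℕ :=
  fun s => (G.map fun t => N.arcST s t).sum

/-- The multiset of postplaces of a finite multiset of transitions. -/
def post (N : Net.{u}) (G : Multiset N.T) : N.S → ℕ :=
  fun s => (G.map fun t => N.arcTS t s).sum

/-- The finite non-empty multiset `G` is a step from marking `M` to marking `M'`. -/
def Step (N : Net.{u}) (M : N.S → ℕ) (G : Multiset N.T) (M' : N.S → ℕ) : Prop :=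
  G ≠ 0 ∧ N.pre G ≤ M ∧ M' = (M - N.pre G) + N.post G

/-- The step `G` can fire in the marking `M`. -/
def CanStep (N : Net.{u}) (M : N.S → ℕ) (G : Multiset N.T) : Prop :=
  ∃ M', N.Step M G M'

/-- Firing of a word of transitions, one after the other. -/
def Fires (N : Net.{u}) : (N.S → ℕ) → List N.T → (N.S → ℕ) → Prop
  | M, [], M' => M = M'
  | M, t :: σ, M' => ∃ M₁, N.Step M {t} M₁ ∧ N.Fires M₁ σ M'

/-- Reachability from the initial marking. -/
def Reachable (N : Net.{u}) (M : N.S → ℕ) : Prop :=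
  ∃ σ : List N.T, N.Fires N.M₀ σ M

open Classical in
/-- The finite non-empty multiset `G` is in (semantic) conflict in `M`; the filter is the
restriction of `G` to `{t}`, keeping all copies of `t`. -/
def InConflict (N : Net.{u}) (M : N.S → ℕ) (G : Multiset N.T) : Prop :=
  G ≠ 0 ∧ (∀ t ∈ G, N.CanStep M (G.filter fun u => u = t)) ∧ ¬ N.CanStep M G

/-- No two-element multiset of transitions is in conflict in a reachable marking. -/
def BinaryConflictFree (N : Net.{u}) : Prop :=
  ∀ (G : Multiset N.T) (M : N.S → ℕ), G.card = 2 → N.Reachable M → ¬ N.InConflict M G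

/-- The net has countably many places and transitions. -/
def IsCountable (N : Net.{u}) : Prop :=
  Countable N.S ∧ Countable N.T

/-- The flow relation as a relation on the disjoint union of places and transitions. -/
def Flow (N : Net.{u}) : N.S ⊕ N.T → N.S ⊕ N.T → Prop
  | .inl s, .inr t => 0 < N.arcST s t
  | .inr t, .inl s => 0 < N.arcTS t s
  | _, _ => False

/-- The transitive closure `F⁺` of the flow relation. -/
def FlowPlus (N : Net.{u}) : N.S ⊕ N.T → N.S ⊕ N.T → Prop :=
  Relation.TransGen N.Flow

open Classical in
/-- The net in which the outgoing arcs of the places `p` and `q` are exchanged. -/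
noncomputable def swap (N : Net.{u}) (p q : N.S) : Net.{u} where
  S := N.S
  T := N.T
  arcST := fun x y => N.arcST (Equiv.swap p q x) y
  arcTS := N.arcTS
  M₀ := N.M₀
  finite_preplaces := fun t =>
    Set.Finite.preimage (f := Equiv.swap p q) (Equiv.swap p q).injective.injOn
      (N.finite_preplaces t)
  nonempty_preplaces := fun t => by
    obtain ⟨s, hs⟩ := N.nonempty_preplaces t
    exact ⟨Equiv.swap p q s, by simpa using hs⟩
  finite_postplaces := N.finite_postplaces

end Net

/-- A net together with a map to the net `N`, sending places to places and transitions to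
transitions. -/
structure NetOver (N : Net.{u}) : Type (u + 1) where
  net : Net.{u}
  mapS : net.S → N.S
  mapT : net.T → N.T

namespace NetOver

variable {N : Net.{u}}

/-- `P` is a GR-process of `N`. -/
structure IsGRProcess (P : NetOver N) : Prop where
  card_pre_le_one : ∀ s, mcard (fun t => P.net.arcTS t s) ≤ 1
  card_post_le_one : ∀ s, mcard (fun t => P.net.arcST s t) ≤ 1
  init_eq_one : ∀ s, (∀ t, P.net.arcTS t s = 0) → P.net.M₀ s = 1
  init_eq_zero : ∀ s, ¬ (∀ t, P.net.arcTS t s = 0) → P.net.M₀ s = 0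
  acyclic : ∀ x, ¬ P.net.FlowPlus x x
  finite_past : ∀ v : P.net.T, {t : P.net.T | P.net.FlowPlus (.inr t) (.inr v)}.Finite
  map_init : ∀ s : N.S,
    (N.M₀ s : ℕ∞) = mcard (fun x : {x : P.net.S // P.mapS x = s} => P.net.M₀ x.1)
  map_pre : ∀ (t : P.net.T) (s : N.S),
    (N.arcST s (P.mapT t) : ℕ∞) =
      mcard (fun x : {x : P.net.S // P.mapS x = s} => P.net.arcST x.1 t)
  map_post : ∀ (t : P.net.T) (s : N.S),
    (N.arcTS (P.mapT t) s : ℕ∞) =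
      mcard (fun x : {x : P.net.S // P.mapS x = s} => P.net.arcTS t x.1)

/-- An isomorphism of nets over `N`. -/
structure Iso (P Q : NetOver N) : Type u where
  eS : P.net.S ≃ Q.net.S
  eT : P.net.T ≃ Q.net.T
  init : ∀ s, Q.net.M₀ (eS s) = P.net.M₀ s
  arcST : ∀ s t, Q.net.arcST (eS s) (eT t) = P.net.arcST s t
  arcTS : ∀ t s, Q.net.arcTS (eT t) (eS s) = P.net.arcTS t s
  mapS : ∀ s, Q.mapS (eS s) = P.mapS s
  mapT : ∀ t, Q.mapT (eT t) = P.mapT t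

/-- `P` and `Q` are isomorphic. -/
def Isomorphic (P Q : NetOver N) : Prop := Nonempty (Iso P Q)

/-- Exchange the outgoing arcs of `p` and `q`. -/
noncomputable def swap (P : NetOver N) (p q : P.net.S) : NetOver N where
  net := P.net.swap p q
  mapS := P.mapS
  mapT := P.mapT

/-- The inverse isomorphism. -/
def Iso.symm {P Q : NetOver N} (e : Iso P Q) : Iso Q P where
  eS := e.eS.symm
  eT := e.eT.symm
  init := fun s => by simpa using (e.init (e.eS.symm s)).symm
  arcST := fun s t => by simpa using (e.arcST (e.eS.symm s) (e.eT.symm t)).symm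
  arcTS := fun t s => by simpa using (e.arcTS (e.eT.symm t) (e.eS.symm s)).symm
  mapS := fun s => by simpa using (e.mapS (e.eS.symm s)).symm
  mapT := fun t => by simpa using (e.mapT (e.eT.symm t)).symm

theorem Iso.flowPlus {P Q : NetOver N} (e : Iso P Q) {x y : P.net.S ⊕ P.net.T}
    (h : P.net.FlowPlus x y) :
    Q.net.FlowPlus (Sum.map e.eS e.eT x) (Sum.map e.eS e.eT y) := by
  refine Relation.TransGen.lift (Sum.map e.eS e.eT) ?_ _ _ h
  rintro (s | t) (s' | t') hxy
  · exact hxy.elim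
  · change 0 < Q.net.arcST (e.eS s) (e.eT t')
    rw [e.arcST]
    exact hxy
  · change 0 < Q.net.arcTS (e.eT t) (e.eS s')
    rw [e.arcTS]
    exact hxy
  · exact hxy.elim

end NetOver

/-- The places `p` and `q` are unordered by `F⁺`. -/
def Net.Unordered (N : Net.{u}) (p q : N.S) : Prop :=
  ¬ N.FlowPlus (.inl p) (.inl q) ∧ ¬ N.FlowPlus (.inl q) (.inl p)

open Classical in
theorem Net.flowPlus_of_swap {N : Net.{u}} (acyclic : ∀ x, ¬ N.FlowPlus x x) {p q c : N.S}
    (h : N.Unordered p q) (hc : c = p ∨ c = q) {x : N.S ⊕ N.T}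
    (hx : (N.swap p q).FlowPlus x (.inl c)) :
    N.FlowPlus (Sum.map (Equiv.swap p q) id x) (.inl c) := by
  have hp : ¬ N.FlowPlus (.inl p) (.inl c) := by
    rcases hc with rfl | rfl
    exacts [acyclic _, h.1]
  have hq : ¬ N.FlowPlus (.inl q) (.inl c) := by
    rcases hc with rfl | rfl
    exacts [h.2, acyclic _]
  unfold Net.FlowPlus at hx
  induction hx using Relation.TransGen.head_induction_on with
  | @single a hab =>
    rcases a with s | t
    · exact hab.elim
    · exact Relation.TransGen.single hab
  | @head a b hab _ ih =>
    rcases a with s | t <;> rcases b with s' | t'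
    · exact hab.elim
    · exact Relation.TransGen.head (show N.Flow (.inl (Equiv.swap p q s)) (.inr t') from hab) ih
    · have hts : N.Flow (.inr t) (.inl s') := hab
      by_cases h1 : s' = p
      · subst h1; simp at ih; exact (hq ih).elim
      · by_cases h2 : s' = q
        · subst h2; simp at ih; exact (hp ih).elim
        · simp [Equiv.swap_apply_of_ne_of_ne h1 h2] at ih
          exact Relation.TransGen.head hts ih
    · exact hab.elim

open Classical in
theorem Net.unordered_swap {N : Net.{u}} (acyclic : ∀ x, ¬ N.FlowPlus x x) {p q : N.S}
    (h : N.Unordered p q) : (N.swap p q).Unordered p q := by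
  constructor
  · intro hx
    have : N.FlowPlus (.inl (Equiv.swap p q p)) (.inl q) :=
      Net.flowPlus_of_swap acyclic h (.inr rfl) hx
    rw [Equiv.swap_apply_left] at this
    exact acyclic _ this
  · intro hx
    have : N.FlowPlus (.inl (Equiv.swap p q q)) (.inl p) :=
      Net.flowPlus_of_swap acyclic h (.inl rfl) hx
    rw [Equiv.swap_apply_right] at this
    exact acyclic _ this

/-- The GR-processes of the net `N`. -/
structure GRProcess (N : Net.{u}) : Type (u + 1) extends NetOver N where
  isProc : toNetOver.IsGRProcess

namespace GRProcess

variable {N : Net.{u}}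

/-- A process is finite if it has finitely many transitions. -/
def IsFinite (P : GRProcess N) : Prop := Finite P.net.T

/-- An exhibition of `P'` as a prefix of `P`, the inclusions of places and transitions being
injective maps. The two conditions on initial markings say that `M₀' = M₀` as multisets. -/
structure PrefixEmbedding (P' P : GRProcess N) : Type u where
  iS : P'.net.S → P.net.S
  iT : P'.net.T → P.net.T
  injS : Function.Injective iS
  injT : Function.Injective iT
  init : ∀ s, P.net.M₀ (iS s) = P'.net.M₀ s
  init_off : ∀ s, s ∉ Set.range iS → P.net.M₀ s = 0
  arcST : ∀ s t, P'.net.arcST s t = P.net.arcST (iS s) (iT t)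
  arcTS : ∀ t s, P'.net.arcTS t s = P.net.arcTS (iT t) (iS s)
  mapS : ∀ s, P'.mapS s = P.mapS (iS s)
  mapT : ∀ t, P'.mapT t = P.mapT (iT t)

/-- `P'` is (up to the names of its places and transitions) a prefix of `P`. -/
def IsPrefix (P' P : GRProcess N) : Prop := Nonempty (PrefixEmbedding P' P)

/-- One step swapping equivalence. -/
def SwapStep (P Q : GRProcess N) : Prop :=
  ∃ p q : P.net.S, P.net.Unordered p q ∧ P.mapS p = P.mapS q ∧
    (P.toNetOver.swap p q).Isomorphic Q.toNetOver

/-- The reflexive and transitive closure of one step swapping equivalence. Since `p = q` is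
allowed, isomorphic processes with at least one place are one step swapping equivalent; the
processes without any place, all of them copies of one empty process, are identified too. -/
def SwapEquiv (P Q : GRProcess N) : Prop :=
  Relation.ReflTransGen
    (fun P Q : GRProcess N => P.toNetOver.Isomorphic Q.toNetOver ∨ SwapStep P Q) P Q

theorem SwapStep.symm {P Q : GRProcess N} (h : SwapStep P Q) : SwapStep Q P := by
  classical
  obtain ⟨p, q, hpq, hπ, ⟨e⟩⟩ := h
  have hu := Net.unordered_swap P.isProc.acyclic hpq
  refine ⟨e.eS p, e.eS q, ⟨fun h => hu.1 ?_, fun h => hu.2 ?_⟩, ?_, ⟨⟨e.eS.symm, e.eT.symm,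
    e.symm.init, ?_, e.symm.arcTS, e.symm.mapS, e.symm.mapT⟩⟩⟩
  · have h' := e.symm.flowPlus h
    simp only [NetOver.Iso.symm, Sum.map_inl] at h'
    erw [Equiv.symm_apply_apply, Equiv.symm_apply_apply] at h'
    exact h'
  · have h' := e.symm.flowPlus h
    simp only [NetOver.Iso.symm, Sum.map_inl] at h'
    erw [Equiv.symm_apply_apply, Equiv.symm_apply_apply] at h'
    exact h'
  · exact ((e.mapS p).trans hπ).trans (e.mapS q).symm
  · intro s t
    obtain ⟨x, rfl⟩ := e.eS.surjective s
    obtain ⟨y, rfl⟩ := e.eT.surjective t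
    have h1 := e.arcST (Equiv.swap p q x) y
    have h2 : e.eS (Equiv.swap p q x) = Equiv.swap (e.eS p) (e.eS q) (e.eS x) :=
      e.eS.injective.map_swap p q x
    rw [h2] at h1
    have h3 : (P.toNetOver.swap p q).net.arcST (Equiv.swap p q x) y = P.net.arcST x y := by
      simp only [NetOver.swap, Net.swap]
      congr 1
      exact Equiv.swap_apply_self p q x
    rw [h3] at h1
    erw [Equiv.symm_apply_apply, Equiv.symm_apply_apply]
    rw [← h1]
    simp only [NetOver.swap, Net.swap]

theorem SwapEquiv.symm {P Q : GRProcess N} (h : SwapEquiv P Q) : SwapEquiv Q P := by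
  have key : ∀ A B : GRProcess N, (A.toNetOver.Isomorphic B.toNetOver ∨ SwapStep A B) →
      (B.toNetOver.Isomorphic A.toNetOver ∨ SwapStep B A) := by
    rintro A B (⟨⟨e⟩⟩ | hs)
    · exact .inl ⟨e.symm⟩
    · exact .inr hs.symm
  unfold SwapEquiv at h ⊢
  induction h with
  | refl => exact .refl
  | tail _ hbc ih => exact .head (key _ _ hbc) ih

end GRProcess

/-- The finite GR-processes of `N`. -/
def FinProcess (N : Net.{u}) : Type (u + 1) := {P : GRProcess N // P.IsFinite}

/-- Swapping equivalence of finite processes. -/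
def finSetoid (N : Net.{u}) : Setoid (FinProcess N) where
  r P Q := GRProcess.SwapEquiv P.1 Q.1
  iseqv := ⟨fun _ => .refl, fun h => h.symm, fun h h' => h.trans h'⟩

/-- The finite BD-processes of `N`: swapping equivalence classes of finite processes. -/
def FinBD (N : Net.{u}) : Type (u + 1) := Quotient (finSetoid N)

namespace FinBD

variable {N : Net.{u}}

/-- The swapping equivalence class of a finite process. -/
def mk (P : FinProcess N) : FinBD N := Quotient.mk (finSetoid N) P

/-- The prefix relation, lifted to equivalence classes of finite processes. -/
def IsPrefix (A B : FinBD N) : Prop :=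
  ∃ Q' Q : FinProcess N, mk Q' = A ∧ Q'.1.IsPrefix Q.1 ∧ mk Q = B

end FinBD

/-- A BD-run: a non-empty, prefix-closed and directed set of finite BD-processes. -/
structure IsBDRun {N : Net.{u}} (R : Set (FinBD N)) : Prop where
  nonempty : R.Nonempty
  prefix_closed : ∀ A B, FinBD.IsPrefix A B → B ∈ R → A ∈ R
  directed : ∀ A ∈ R, ∀ B ∈ R, ∃ C ∈ R, FinBD.IsPrefix A C ∧ FinBD.IsPrefix B C

/-- The BD-run of a process `P`: the prefix-closure of the set of classes of finite prefixes
of `P`. -/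
def GRProcess.bdRun {N : Net.{u}} (P : GRProcess N) : Set (FinBD N) :=
  {A | ∃ P' : FinProcess N, P'.1.IsPrefix P ∧ FinBD.IsPrefix A (FinBD.mk P')}

/-- Swapping equivalence of (possibly infinite) processes. -/
def bdSetoid (N : Net.{u}) : Setoid (GRProcess N) where
  r P Q := P.bdRun = Q.bdRun
  iseqv := ⟨fun _ => rfl, fun h => h.symm, fun h h' => h.trans h'⟩

/-- The BD-processes of `N`: swapping equivalence classes of processes. -/
def BDProcess (N : Net.{u}) : Type (u + 1) := Quotient (bdSetoid N)

namespace BDProcess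

variable {N : Net.{u}}

/-- The BD-run of a BD-process, i.e. that of any of its members. -/
def bdRun (B : BDProcess N) : Set (FinBD N) :=
  Quotient.lift GRProcess.bdRun (fun _ _ h => h) B

/-- A BD-process is run-maximal if its BD-run is maximal, with respect to inclusion, among all
BD-runs of the net. -/
def RunMaximal (B : BDProcess N) : Prop := Maximal IsBDRun B.bdRun

end BDProcess

/-! In a binary-conflict-free net the set of all finite BD-processes is itself directed, hence a
BD-run, and trivially the largest one (`Net.BinaryConflictFree.isBDRun_univ`). So run-maximal means
having all finite BD-processes in the run, and since a BD-process is determined by its run, at most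
one can be run-maximal.

Directedness is proved on firing sequences. A sequence `τ`, with pauses allowed so that finite and
infinite sequences are treated alike, has a canonical process `fifoProcess`: the tokens in each
place are numbered in order of arrival and consumed in that order. If a finite process is executed
in an order compatible with its flow, swapping equally labelled places removes each inversion (a
token born no later but consumed later than another), and a weighted sum strictly drops. Hence the
process is swapping equivalent to the first-in-first-out process of that linearisation
(`IsLinearisation.swapEquiv_fifo`), and every class comes from a firing sequence
(`FinBD.exists_firingSequence`).

Exchanging adjacent concurrent transitions does not change the class: if enough tokens for both are
present beforehand, first-in-first-out consumption creates no dependency between them, so the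
exchanged list is a second linearisation of the same process (`Net.Adjacent.mk_eq`).
Binary-conflict-freeness makes distinct enabled transitions concurrent, which gives a diamond
property and, by tiling, confluence up to such exchanges (`Net.BinaryConflictFree.confluent`).

For existence, countably many transitions give countably many firing sequences. Extending one
sequence repeatedly so as to absorb each of them in turn yields a limit sequence whose process has
every finite BD-process in its run. -/

/-! ### Counting -/

theorem mcard_le_one {X : Type u} {A : X → ℕ} (h1 : ∀ x, A x ≤ 1)
    (h : ∀ x y, 0 < A x → 0 < A y → x = y) : mcard A ≤ 1 := by
  rw [mcard, ENat.card_le_one_iff_subsingleton]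
  refine ⟨fun ⟨x, i⟩ ⟨y, j⟩ => ?_⟩
  obtain rfl := h x y i.pos j.pos
  have : i = j := by
    have := h1 x
    ext
    omega
  rw [this]

theorem eq_of_mcard_le_one {X : Type u} {A : X → ℕ} (h : mcard A ≤ 1) {x y : X}
    (hx : 0 < A x) (hy : 0 < A y) : x = y := by
  rw [mcard, ENat.card_le_one_iff_subsingleton] at h
  exact congrArg Sigma.fst (h.elim ⟨x, ⟨0, hx⟩⟩ ⟨y, ⟨0, hy⟩⟩)

theorem le_one_of_mcard_le_one {X : Type u} {A : X → ℕ} (h : mcard A ≤ 1) (x : X) :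
    A x ≤ 1 := by
  rw [mcard, ENat.card_le_one_iff_subsingleton] at h
  by_contra! hx
  have := h.elim ⟨x, ⟨0, by omega⟩⟩ ⟨x, ⟨1, hx⟩⟩
  simp at this

theorem mcard_eq_encard {X : Type u} {A : X → ℕ} (h : ∀ x, A x ≤ 1) :
    mcard A = {x | 0 < A x}.encard := by
  refine ENat.card_congr ⟨fun x => ⟨x.1, x.2.pos⟩, fun x => ⟨x.1, ⟨0, x.2⟩⟩, ?_, fun x => rfl⟩
  rintro ⟨x, i⟩
  have : (⟨0, i.pos⟩ : Fin (A x)) = i := by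
    have := h x
    ext
    simp only
    omega
  simp [this]

theorem mcard_comp_equiv {X Y : Type u} (A : X → ℕ) (e : Y ≃ X) :
    mcard (fun y => A (e y)) = mcard A :=
  ENat.card_congr (Equiv.sigmaCongrLeft (β := fun x => Fin (A x)) e)

/-- Summing the sizes of the level sets of `f` below level `i`. -/
theorem encard_lt_eq_sum {α : Type u} {f : α → ℕ∞} {c : ℕ → ℕ}
    (h : ∀ i : ℕ, {x | f x = i}.encard = c i) (i : ℕ) :
    {x | f x < i}.encard = ((∑ j ∈ Finset.range i, c j : ℕ) : ℕ∞) := by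
  induction i with
  | zero => simp
  | succ i ih =>
    have hu : {x | f x < (i + 1 : ℕ)} = {x | f x < i} ∪ {x | f x = i} := by
      ext x
      simp only [Set.mem_ofPred_eq, Set.mem_union, Nat.cast_add, Nat.cast_one]
      rw [ENat.lt_add_one_iff (ENat.natCast_ne_top i), le_iff_lt_or_eq]
    rw [hu, Set.encard_union_eq, ih, h, Finset.sum_range_succ, Nat.cast_add]
    rw [Set.disjoint_left]
    intro x hx hx'
    exact hx.ne hx'

/-- Cardinalities decide: a member `m` puts `m + 1` numbers into `A`, while a non-member `m` leaves
room for at most `m`. -/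
theorem mem_iff_lt_of_isLowerSet {A : Set ℕ} (hA : IsLowerSet A) {n : ℕ} (hn : A.encard = n)
    (m : ℕ) : m ∈ A ↔ m < n := by
  constructor
  · intro hm
    have h1 : (Set.Iic m).encard ≤ A.encard := Set.encard_le_encard fun k hk => hA hk hm
    rw [hn, ← Finset.coe_Iic, Set.encard_coe_eq_coe_finsetCard, Nat.card_Iic] at h1
    exact_mod_cast h1
  · intro hm
    by_contra hmA
    have h1 : A.encard ≤ (Set.Iio m).encard := Set.encard_le_encard fun k hk => by
      by_contra hk'
      exact hmA (hA (not_lt.1 hk') hk)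
    rw [hn, ← Finset.coe_Iio, Set.encard_coe_eq_coe_finsetCard, Nat.card_Iio] at h1
    have : n ≤ m := by exact_mod_cast h1
    omega

/-- If `f` is monotone along the enumeration `κ`, the sizes of its lower level sets determine
it. -/
theorem mem_image_iff_of_enumeration {α : Type u} {f : α → ℕ∞} {κ : α → ℕ}
    (inj : Function.Injective κ) (lower : IsLowerSet (Set.range κ))
    (mono : ∀ x y, κ x < κ y → f x ≤ f y) {i : ℕ∞} {n : ℕ} (hn : {x | f x < i}.encard = n)
    (m : ℕ) : m ∈ κ '' {x | f x < i} ↔ m < n := by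
  rw [← inj.encard_image] at hn
  refine mem_iff_lt_of_isLowerSet ?_ hn m
  rintro _ m hm ⟨y, hy, rfl⟩
  obtain ⟨z, rfl⟩ := lower hm ⟨y, rfl⟩
  rcases hm.lt_or_eq with h | h
  · exact ⟨z, (mono z y h).trans_lt hy, rfl⟩
  · exact ⟨y, hy, h.symm⟩

theorem lt_iff_of_enumeration {α : Type u} {f : α → ℕ∞} {κ : α → ℕ}
    (inj : Function.Injective κ) (lower : IsLowerSet (Set.range κ))
    (mono : ∀ x y, κ x < κ y → f x ≤ f y) {i : ℕ∞} {n : ℕ} (hn : {x | f x < i}.encard = n)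
    (x : α) : f x < i ↔ κ x < n := by
  rw [← mem_image_iff_of_enumeration inj lower mono hn, inj.mem_set_image, Set.mem_ofPred_eq]

theorem exists_enumeration {α : Type u} [Finite α] {β : Type*} [LinearOrder β] (f : α → β) :
    ∃ κ : α → ℕ, Function.Injective κ ∧ IsLowerSet (Set.range κ) ∧
      ∀ x y, κ x < κ y → f x ≤ f y := by
  obtain ⟨n, ⟨e⟩⟩ := Finite.exists_equiv_fin α
  have hm := Tuple.monotone_sort (f ∘ e.symm)
  set σ := Tuple.sort (f ∘ e.symm)
  refine ⟨fun x => σ.symm (e x), fun x y h => ?_, ?_, fun x y h => ?_⟩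
  · simpa using Fin.ext h
  · rintro _ m hm ⟨x, rfl⟩
    exact ⟨e.symm (σ ⟨m, hm.trans_lt (σ.symm (e x)).2⟩), by simp⟩
  · have := hm (a := σ.symm (e x)) (b := σ.symm (e y)) (Fin.le_def.2 h.le)
    simpa using this

open Classical in
/-- Exchanging the weights of an inversion decreases the weighted sum. -/
theorem finsum_mul_swap_lt {X : Type u} {k w : X → ℕ} (hw : (Function.support w).Finite) {x y : X}
    (hk : k x < k y) (hxy : w x < w y) :
    ∑ᶠ z, k z * w (Equiv.swap x y z) < ∑ᶠ z, k z * w z := by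
  have hne : x ≠ y := by rintro rfl; exact hk.false
  set U := hw.toFinset ∪ {x, y}
  have hU : ∀ z, z ∉ U → w z = 0 ∧ z ≠ x ∧ z ≠ y := fun z hz => by
    simpa [U, not_or, and_comm, and_assoc] using hz
  rw [finsum_eq_sum_of_support_subset (s := U), finsum_eq_sum_of_support_subset (s := U)]
  · have hx : x ∈ U := by simp [U]
    have hy : y ∈ U.erase x := by simp [U, hne.symm]
    rw [← Finset.add_sum_erase _ _ hx, ← Finset.add_sum_erase _ _ hy,
      ← Finset.add_sum_erase _ _ hx, ← Finset.add_sum_erase _ _ hy]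
    have : ∑ z ∈ (U.erase x).erase y, k z * w (Equiv.swap x y z) =
        ∑ z ∈ (U.erase x).erase y, k z * w z := Finset.sum_congr rfl fun z hz => by
      simp only [Finset.mem_erase] at hz
      rw [Equiv.swap_apply_of_ne_of_ne hz.2.1 hz.1]
    rw [this, Equiv.swap_apply_left, Equiv.swap_apply_right]
    -- The two sides differ by `(k y - k x) * (w y - w x)`.
    nlinarith
  · intro z hz
    by_contra h
    exact hz (by simp [(hU z h).1])
  · intro z hz
    by_contra h
    obtain ⟨h1, h2, h3⟩ := hU z h
    exact hz (by simp [Equiv.swap_apply_of_ne_of_ne h2 h3, h1])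

/-! ### Acyclicity from a ranking -/

namespace Net

/-- A ranking of places and transitions that strictly increases from transitions to places and
weakly from places to transitions. -/
structure IsRanking (N : Net.{u}) (b : N.S → ℕ) (r : N.T → ℕ) : Prop where
  lt : ∀ t x, 0 < N.arcTS t x → r t < b x
  le : ∀ x t, 0 < N.arcST x t → b x ≤ r t

namespace IsRanking

variable {N : Net.{u}} {b : N.S → ℕ} {r : N.T → ℕ}

/-- Doubling makes room between consecutive ranks: transitions get odd values and places even ones,
so weak increase from a place to a transition becomes strict. -/
theorem flowPlus_lt (h : N.IsRanking b r) {x y : N.S ⊕ N.T} (hxy : N.FlowPlus x y) :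
    Sum.elim (fun s => 2 * b s) (fun t => 2 * r t + 1) x <
      Sum.elim (fun s => 2 * b s) (fun t => 2 * r t + 1) y := by
  have key : ∀ x y, N.Flow x y → Sum.elim (fun s => 2 * b s) (fun t => 2 * r t + 1) x <
      Sum.elim (fun s => 2 * b s) (fun t => 2 * r t + 1) y := by
    rintro (s | t) (s' | t') hf
    · exact hf.elim
    · have := h.le _ _ hf
      simp only [Sum.elim_inl, Sum.elim_inr]
      omega
    · have := h.lt _ _ hf
      simp only [Sum.elim_inl, Sum.elim_inr]
      omega
    · exact hf.elim
  unfold FlowPlus at hxy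
  induction hxy with
  | single hf => exact key _ _ hf
  | tail _ hf ih => exact ih.trans (key _ _ hf)

theorem acyclic (h : N.IsRanking b r) (x : N.S ⊕ N.T) : ¬ N.FlowPlus x x :=
  fun hx => (h.flowPlus_lt hx).false

theorem finite_past (h : N.IsRanking b r) (inj : Function.Injective r) (v : N.T) :
    {t : N.T | N.FlowPlus (.inr t) (.inr v)}.Finite := by
  refine ((Set.finite_Iio (r v)).preimage inj.injOn).subset fun t ht => ?_
  have := h.flowPlus_lt ht
  simp only [Sum.elim_inr] at this
  simp only [Set.mem_preimage, Set.mem_Iio]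
  omega

/-- A place below another place has a consumer that comes before the birth of the latter. -/
theorem exists_consumer (h : N.IsRanking b r) {x y : N.S} (hxy : N.FlowPlus (.inl x) (.inl y)) :
    ∃ t, 0 < N.arcST x t ∧ r t < b y := by
  obtain ⟨z, hz, hzy⟩ := Relation.TransGen.head'_iff.1 hxy
  rcases z with s | t
  · exact hz.elim
  · refine ⟨t, hz, ?_⟩
    rcases Relation.reflTransGen_iff_eq_or_transGen.1 hzy with h' | h'
    · simp at h'
    · have := h.flowPlus_lt h'
      simp only [Sum.elim_inl, Sum.elim_inr] at this
      omega

end IsRanking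

end Net

/-! ### The first-in-first-out process of a sequence of transitions -/

namespace Net

variable (N : Net.{u})

/-- The number of tokens that `s` receives from an optional transition. -/
def optPost (s : N.S) : Option N.T → ℕ
  | none => 0
  | some t => N.arcTS t s

/-- The number of tokens that an optional transition takes from `s`. -/
def optPre (s : N.S) : Option N.T → ℕ
  | none => 0
  | some t => N.arcST s t

/-- The number of tokens that occur in `s` before time `i`. -/
def produced (τ : ℕ → Option N.T) (i : ℕ) (s : N.S) : ℕ :=
  N.M₀ s + ∑ j ∈ Finset.range i, N.optPost s (τ j)

/-- The number of tokens taken from `s` before time `i`. -/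
def consumed (τ : ℕ → Option N.T) (i : ℕ) (s : N.S) : ℕ :=
  ∑ j ∈ Finset.range i, N.optPre s (τ j)

/-- The sequence `τ` of transitions and pauses can be fired from the initial marking. -/
def Valid (τ : ℕ → Option N.T) : Prop :=
  ∀ i t, τ i = some t → ∀ s, N.consumed τ i s + N.arcST s t ≤ N.produced τ i s

variable {N} {τ : ℕ → Option N.T} {s : N.S} {i : ℕ} {t : N.T}

theorem produced_zero : N.produced τ 0 s = N.M₀ s := by simp [produced]

theorem consumed_zero : N.consumed τ 0 s = 0 := by simp [consumed]

theorem produced_succ : N.produced τ (i + 1) s = N.produced τ i s + N.optPost s (τ i) := by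
  simp [produced, Finset.sum_range_succ, add_assoc]

theorem consumed_succ : N.consumed τ (i + 1) s = N.consumed τ i s + N.optPre s (τ i) := by
  simp [consumed, Finset.sum_range_succ]

theorem produced_succ_of_some (h : τ i = some t) :
    N.produced τ (i + 1) s = N.produced τ i s + N.arcTS t s := by
  rw [produced_succ, h, optPost]

theorem consumed_succ_of_some (h : τ i = some t) :
    N.consumed τ (i + 1) s = N.consumed τ i s + N.arcST s t := by
  rw [consumed_succ, h, optPre]

theorem produced_mono (τ : ℕ → Option N.T) (s : N.S) : Monotone fun i => N.produced τ i s :=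
  monotone_nat_of_le_succ fun i => by rw [produced_succ]; exact Nat.le_add_right _ _

theorem consumed_mono (τ : ℕ → Option N.T) (s : N.S) : Monotone fun i => N.consumed τ i s :=
  monotone_nat_of_le_succ fun i => by rw [consumed_succ]; exact Nat.le_add_right _ _

theorem produced_congr {τ' : ℕ → Option N.T} (h : ∀ j < i, τ' j = τ j) :
    N.produced τ' i s = N.produced τ i s := by
  unfold produced
  rw [Finset.sum_congr rfl fun j hj => by rw [h j (Finset.mem_range.1 hj)]]

theorem consumed_congr {τ' : ℕ → Option N.T} (h : ∀ j < i, τ' j = τ j) :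
    N.consumed τ' i s = N.consumed τ i s := by
  unfold consumed
  rw [Finset.sum_congr rfl fun j hj => by rw [h j (Finset.mem_range.1 hj)]]

theorem eq_of_mem_Ico_of_monotone {f : ℕ → ℕ} (hf : Monotone f) {i j k : ℕ}
    (hi : f i ≤ k ∧ k < f (i + 1)) (hj : f j ≤ k ∧ k < f (j + 1)) : i = j := by
  rcases lt_trichotomy i j with h | h | h
  · have := hf (Nat.succ_le_of_lt h)
    simp only [Nat.succ_eq_add_one] at this
    omega
  · exact h
  · have := hf (Nat.succ_le_of_lt h)
    simp only [Nat.succ_eq_add_one] at this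
    omega

variable (N) in
/-- The tokens of the sequence `τ`: the `k`-th token ever present in the place `s`. -/
abbrev Token (τ : ℕ → Option N.T) : Type u :=
  {x : N.S × ℕ // ∃ i, x.2 < N.produced τ i x.1}

variable (N) in
/-- The transition occurrences of the sequence `τ`. -/
abbrev Occ (τ : ℕ → Option N.T) : Type u :=
  {x : N.T × ℕ // τ x.2 = some x.1}

theorem Occ.ext' {x y : N.Occ τ} (h : x.1.2 = y.1.2) : x = y := by
  obtain ⟨⟨t, i⟩, hx⟩ := x
  obtain ⟨⟨t', j⟩, hy⟩ := y
  obtain rfl : i = j := h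
  obtain rfl : t = t' := Option.some_injective _ (hx.symm.trans hy)
  rfl

theorem Occ.produced_succ (y : N.Occ τ) :
    N.produced τ (y.1.2 + 1) s = N.produced τ y.1.2 s + N.arcTS y.1.1 s :=
  produced_succ_of_some y.2

theorem Occ.consumed_succ (y : N.Occ τ) :
    N.consumed τ (y.1.2 + 1) s = N.consumed τ y.1.2 s + N.arcST s y.1.1 :=
  consumed_succ_of_some y.2

theorem Valid.consumed_succ_le (h : N.Valid τ) (y : N.Occ τ) (s : N.S) :
    N.consumed τ (y.1.2 + 1) s ≤ N.produced τ y.1.2 s := by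
  rw [y.consumed_succ]
  exact h _ _ y.2 s

theorem Token.finite_of_subset {A : Set (N.Token τ)} {B : Set N.S} (hB : B.Finite) {i : ℕ}
    (h : ∀ x ∈ A, x.1.1 ∈ B ∧ x.1.2 < N.produced τ i x.1.1) : A.Finite := by
  refine Set.Finite.of_finite_image (f := Subtype.val) ?_ Subtype.val_injective.injOn
  refine (hB.biUnion fun s _ => (Set.finite_singleton s).prod
    (Set.finite_Iio (N.produced τ i s))).subset ?_
  rintro _ ⟨x, hx, rfl⟩
  simp only [Set.mem_iUnion]
  exact ⟨x.1.1, (h x hx).1, rfl, (h x hx).2⟩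

open Classical in
/-- The net underlying the first-in-first-out process of `τ`. -/
noncomputable abbrev fifo (τ : ℕ → Option N.T) (h : N.Valid τ) : Net.{u} where
  S := N.Token τ
  T := N.Occ τ
  arcST x y :=
    if N.consumed τ y.1.2 x.1.1 ≤ x.1.2 ∧ x.1.2 < N.consumed τ (y.1.2 + 1) x.1.1 then 1 else 0
  arcTS y x :=
    if N.produced τ y.1.2 x.1.1 ≤ x.1.2 ∧ x.1.2 < N.produced τ (y.1.2 + 1) x.1.1 then 1 else 0
  M₀ x := if x.1.2 < N.M₀ x.1.1 then 1 else 0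
  finite_preplaces y := Token.finite_of_subset (N.finite_preplaces y.1.1) (i := y.1.2)
    fun x hx => by
      have hx : 0 < ite _ _ _ := hx
      split_ifs at hx with hc
      · have h1 := h.consumed_succ_le y x.1.1
        rw [y.consumed_succ] at hc h1
        exact ⟨show 0 < _ by omega, by omega⟩
      · omega
  nonempty_preplaces y := by
    obtain ⟨s, hs⟩ := N.nonempty_preplaces y.1.1
    have h1 := h.consumed_succ_le y s
    have h2 := y.consumed_succ (s := s)
    have hs : 0 < N.arcST s y.1.1 := hs
    have hk : N.consumed τ y.1.2 s < N.consumed τ (y.1.2 + 1) s := by omega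
    -- The oldest token of `s` not yet consumed.
    refine ⟨⟨(s, N.consumed τ y.1.2 s), y.1.2, by simp only; omega⟩, ?_⟩
    simp only [Set.mem_ofPred_eq, le_refl, hk, and_self, if_true]
    exact one_pos
  finite_postplaces y := Token.finite_of_subset (N.finite_postplaces y.1.1) (i := y.1.2 + 1)
    fun x hx => by
      have hx : 0 < ite _ _ _ := hx
      split_ifs at hx with hc
      · have := hc.1.trans_lt hc.2
        rw [y.produced_succ] at this
        exact ⟨show 0 < _ by omega, hc.2⟩
      · omega

section fifo

variable {h : N.Valid τ}

theorem fifo_arcST (x : N.Token τ) (y : N.Occ τ) : 0 < (N.fifo τ h).arcST x y ↔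
    N.consumed τ y.1.2 x.1.1 ≤ x.1.2 ∧ x.1.2 < N.consumed τ (y.1.2 + 1) x.1.1 := by
  simp only
  split_ifs <;> simp [*]

theorem fifo_arcTS (x : N.Token τ) (y : N.Occ τ) : 0 < (N.fifo τ h).arcTS y x ↔
    N.produced τ y.1.2 x.1.1 ≤ x.1.2 ∧ x.1.2 < N.produced τ (y.1.2 + 1) x.1.1 := by
  simp only
  split_ifs <;> simp [*]

theorem fifo_M₀ (x : N.Token τ) : 0 < (N.fifo τ h).M₀ x ↔ x.1.2 < N.M₀ x.1.1 := by
  simp only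
  split_ifs <;> simp [*]

theorem fifo_le_one (x : N.Token τ) (y : N.Occ τ) : (N.fifo τ h).arcST x y ≤ 1 ∧
    (N.fifo τ h).arcTS y x ≤ 1 := by
  simp only
  refine ⟨?_, ?_⟩ <;> split_ifs <;> simp

theorem fifo_M₀_le_one (x : N.Token τ) : (N.fifo τ h).M₀ x ≤ 1 := by
  simp only
  split_ifs <;> simp

end fifo

/-- The first time at which a token is present. -/
noncomputable def Token.birth (x : N.Token τ) : ℕ := sInf {i | x.1.2 < N.produced τ i x.1.1}

theorem Token.lt_produced_iff (x : N.Token τ) :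
    x.1.2 < N.produced τ i x.1.1 ↔ x.birth ≤ i := by
  constructor
  · intro h
    exact Nat.sInf_le h
  · intro h
    exact lt_of_lt_of_le (Nat.sInf_mem (s := {i | x.1.2 < N.produced τ i x.1.1}) x.2)
      (produced_mono τ x.1.1 h)

/-- A token produced at time `i` is not yet present at time `i`; by validity, a token taken at time
`i` is. -/
theorem fifo_isRanking (h : N.Valid τ) :
    (N.fifo τ h).IsRanking (Token.birth (τ := τ)) (fun y : N.Occ τ => y.1.2) where
  lt y x hyx := by
    replace hyx := (fifo_arcTS (h := h) x y).1 hyx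
    by_contra hb
    exact absurd ((Token.lt_produced_iff x).2 (not_lt.1 hb)) (not_lt.2 hyx.1)
  le x y hxy := by
    replace hxy := (fifo_arcST (h := h) x y).1 hxy
    exact (Token.lt_produced_iff x).1 (hxy.2.trans_le (h.consumed_succ_le y _))

/-- The number of a token identifies it within `s`, and the bound on `b` ensures that all numbers
below `b` occur. The three weight conditions on the process count such intervals. -/
theorem encard_token (s : N.S) {a b i : ℕ} (hb : b ≤ N.produced τ i s) :
    {x : {x : N.Token τ // x.1.1 = s} | a ≤ x.1.1.2 ∧ x.1.1.2 < b}.encard = (b - a : ℕ) := by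
  have hinj : Function.Injective fun x : {x : N.Token τ // x.1.1 = s} => x.1.1.2 := by
    rintro ⟨⟨⟨s, k⟩, hx⟩, rfl⟩ ⟨⟨⟨s', k'⟩, hx'⟩, hs⟩ hk
    simp only at hs hk
    subst hs hk
    rfl
  rw [← hinj.encard_image, ← Nat.card_Ico, ← Set.encard_coe_eq_coe_finsetCard, Finset.coe_Ico]
  congr 1
  ext k
  constructor
  · rintro ⟨x, hx, rfl⟩
    exact hx
  · intro hk
    exact ⟨⟨⟨(s, k), i, hk.2.trans_le hb⟩, rfl⟩, hk, rfl⟩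

end Net

section

open Net

variable {N : Net.{u}} {τ : ℕ → Option N.T}

theorem fifo_map_init (h : N.Valid τ) (s : N.S) : (N.M₀ s : ℕ∞) =
    mcard (fun x : {x : N.Token τ // x.1.1 = s} => (N.fifo τ h).M₀ x.1) := by
  rw [mcard_eq_encard fun x => fifo_M₀_le_one _]
  have := encard_token (τ := τ) (i := 0) (a := 0) s produced_zero.ge
  rw [Nat.sub_zero] at this
  rw [← this]
  congr 1
  ext ⟨x, rfl⟩
  simpa using (fifo_M₀ (h := h) x).symm

theorem fifo_map_pre (h : N.Valid τ) (y : N.Occ τ) (s : N.S) : (N.arcST s y.1.1 : ℕ∞) =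
    mcard (fun x : {x : N.Token τ // x.1.1 = s} => (N.fifo τ h).arcST x.1 y) := by
  rw [mcard_eq_encard fun x => (fifo_le_one _ _).1]
  have := encard_token s (a := N.consumed τ y.1.2 s) (h.consumed_succ_le y s)
  rw [y.consumed_succ, Nat.add_sub_cancel_left] at this
  rw [← this]
  congr 1
  ext ⟨x, rfl⟩
  simpa [Occ.consumed_succ] using (fifo_arcST (h := h) x y).symm

theorem fifo_map_post (h : N.Valid τ) (y : N.Occ τ) (s : N.S) : (N.arcTS y.1.1 s : ℕ∞) =
    mcard (fun x : {x : N.Token τ // x.1.1 = s} => (N.fifo τ h).arcTS y x.1) := by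
  rw [mcard_eq_encard fun x => (fifo_le_one _ _).2]
  have := encard_token (τ := τ) (i := y.1.2 + 1) s (a := N.produced τ y.1.2 s) le_rfl
  rw [y.produced_succ, Nat.add_sub_cancel_left] at this
  rw [← this]
  congr 1
  ext ⟨x, rfl⟩
  simpa [Occ.produced_succ] using (fifo_arcTS (h := h) x y).symm

/-- A non-initial token has a positive birth `i + 1`; the count grows at time `i`, so `τ i` is no
pause. -/
theorem fifo_exists_producer (h : N.Valid τ) (x : N.Token τ) (hx : ¬ x.1.2 < N.M₀ x.1.1) :
    ∃ y, 0 < (N.fifo τ h).arcTS y x := by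
  have hb := (Token.lt_produced_iff (i := Token.birth x) x).2 le_rfl
  rcases hi : Token.birth x with _ | i
  · rw [hi, produced_zero] at hb
    exact absurd hb hx
  · have hl : ¬ x.1.2 < N.produced τ i x.1.1 := by
      rw [Token.lt_produced_iff, hi]
      omega
    rw [hi] at hb
    rcases ht : τ i with _ | t
    · rw [produced_succ, ht, optPost] at hb
      omega
    · exact ⟨⟨(t, i), ht⟩, (fifo_arcTS _ _).2 ⟨not_lt.1 hl, hb⟩⟩

/-- The first-in-first-out process of a sequence of transitions. -/
noncomputable abbrev fifoProcess (τ : ℕ → Option N.T) (h : N.Valid τ) : GRProcess N where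
  net := N.fifo τ h
  mapS x := x.1.1
  mapT y := y.1.1
  isProc :=
    { card_pre_le_one := fun x =>
        mcard_le_one (fun y => (fifo_le_one (h := h) x y).2) fun y y' hy hy' =>
        Occ.ext' (eq_of_mem_Ico_of_monotone (produced_mono τ _)
          ((fifo_arcTS (h := h) x y).1 hy) ((fifo_arcTS (h := h) x y').1 hy'))
      card_post_le_one := fun x =>
        mcard_le_one (fun y => (fifo_le_one (h := h) x y).1) fun y y' hy hy' =>
        Occ.ext' (eq_of_mem_Ico_of_monotone (consumed_mono τ _)
          ((fifo_arcST (h := h) x y).1 hy) ((fifo_arcST (h := h) x y').1 hy'))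
      init_eq_one := fun (x : N.Token τ) hx => by
        refine if_pos ?_
        by_contra hlt
        obtain ⟨y, hy⟩ := fifo_exists_producer h x hlt
        exact hy.ne' (hx y)
      init_eq_zero := fun (x : N.Token τ) hx => by
        push Not at hx
        obtain ⟨y, hy⟩ := hx
        have h1 := (fifo_arcTS (h := h) x y).1 (Nat.pos_of_ne_zero hy)
        have h2 := produced_mono τ x.1.1 (Nat.zero_le y.1.2)
        simp only [produced_zero] at h2
        exact if_neg (by omega)
      acyclic := (fifo_isRanking h).acyclic
      finite_past := (fifo_isRanking h).finite_past fun _ _ => Occ.ext'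
      map_init := fifo_map_init h
      map_pre := fifo_map_pre h
      map_post := fifo_map_post h }

/-- The process of an initial part of a sequence is a prefix. -/
theorem fifoProcess_isPrefix {τ' : ℕ → Option N.T} (h' : N.Valid τ') (h : N.Valid τ) (n : ℕ)
    (hlt : ∀ i < n, τ' i = τ i) (hge : ∀ i ≥ n, τ' i = none) :
    (fifoProcess τ' h').IsPrefix (fifoProcess τ h) := by
  have hn : ∀ y : N.Occ τ', y.1.2 < n := fun y => by
    by_contra hy
    have := y.2
    rw [hge _ (not_lt.1 hy)] at this
    cases this
  have hP : ∀ i ≤ n, ∀ s, N.produced τ' i s = N.produced τ i s := fun i hi s =>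
    produced_congr fun j hj => hlt j (hj.trans_le hi)
  have hC : ∀ i ≤ n, ∀ s, N.consumed τ' i s = N.consumed τ i s := fun i hi s =>
    consumed_congr fun j hj => hlt j (hj.trans_le hi)
  -- Past `n` there are only pauses in `τ'`, so production stops there.
  have hle : ∀ i s, N.produced τ' i s ≤ N.produced τ n s := fun i s => by
    unfold produced
    rcases le_total i n with hi | hi
    · exact (hP i hi s).le.trans (produced_mono τ s hi)
    · obtain ⟨d, rfl⟩ := Nat.exists_eq_add_of_le hi
      induction d with
      | zero => exact (hP n le_rfl s).le
      | succ d ih =>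
        have := ih (by omega)
        rw [← add_assoc, Finset.sum_range_succ, hge _ (by omega), optPost, add_zero]
        exact this
  let iS : N.Token τ' → N.Token τ := fun x =>
    ⟨x.1, n, x.2.elim fun i hi => hi.trans_le (hle i _)⟩
  let iT : N.Occ τ' → N.Occ τ := fun y => ⟨y.1, by rw [← hlt _ (hn y)]; exact y.2⟩
  exact ⟨{
    iS := iS
    iT := iT
    injS := fun x y hxy => Subtype.ext (congrArg (fun z : N.Token τ => z.1) hxy)
    injT := fun x y hxy => Subtype.ext (congrArg (fun z : N.Occ τ => z.1) hxy)
    init := fun x => rfl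
    init_off := fun x hx => by
      by_contra h0
      have h1 := (fifo_M₀ (h := h) x).1 (Nat.pos_of_ne_zero h0)
      exact hx ⟨⟨x.1, 0, by rw [produced_zero]; exact h1⟩, rfl⟩
    arcST := fun x y => by
      have hy := hn y
      simp only [iS, iT]
      rw [hC _ hy.le, hC _ hy]
    arcTS := fun y x => by
      have hy := hn y
      simp only [iS, iT]
      rw [hP _ hy.le, hP _ hy]
    mapS := fun x => rfl
    mapT := fun y => rfl }⟩

end

/-! ### Linearisations of processes -/

namespace GRProcess

variable {N : Net.{u}} (P : GRProcess N)

theorem arcST_le_one (x : P.net.S) (t : P.net.T) : P.net.arcST x t ≤ 1 :=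
  le_one_of_mcard_le_one (P.isProc.card_post_le_one x) t

theorem arcTS_le_one (t : P.net.T) (x : P.net.S) : P.net.arcTS t x ≤ 1 :=
  le_one_of_mcard_le_one (P.isProc.card_pre_le_one x) t

theorem M₀_le_one (x : P.net.S) : P.net.M₀ x ≤ 1 := by
  by_cases h : ∀ t, P.net.arcTS t x = 0
  · exact (P.isProc.init_eq_one x h).le
  · exact (P.isProc.init_eq_zero x h).le.trans zero_le_one

open Classical in
/-- The time at which the place `x` is filled, if the transitions fire at the times `r`. -/
noncomputable def birth (r : P.net.T → ℕ) (x : P.net.S) : ℕ :=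
  -- The shift by one keeps birth `0` for the initially marked places.
  if h : ∃ t, 0 < P.net.arcTS t x then r h.choose + 1 else 0

open Classical in
/-- The time at which the place `x` is emptied, if the transitions fire at the times `r`. -/
noncomputable def death (r : P.net.T → ℕ) (x : P.net.S) : ℕ∞ :=
  if h : ∃ t, 0 < P.net.arcST x t then (r h.choose : ℕ∞) else ⊤

variable {P} {r : P.net.T → ℕ}

theorem birth_eq {t : P.net.T} {x : P.net.S} (h : 0 < P.net.arcTS t x) :
    P.birth r x = r t + 1 := by
  have h' : ∃ t, 0 < P.net.arcTS t x := ⟨t, h⟩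
  rw [birth, dif_pos h', eq_of_mcard_le_one (P.isProc.card_pre_le_one x) h h'.choose_spec]

theorem death_eq {t : P.net.T} {x : P.net.S} (h : 0 < P.net.arcST x t) :
    P.death r x = r t := by
  have h' : ∃ t, 0 < P.net.arcST x t := ⟨t, h⟩
  rw [death, dif_pos h', eq_of_mcard_le_one (P.isProc.card_post_le_one x) h h'.choose_spec]

theorem birth_eq_zero_iff {x : P.net.S} : P.birth r x = 0 ↔ 0 < P.net.M₀ x := by
  by_cases h : ∃ t, 0 < P.net.arcTS t x
  · have h0 : ¬ ∀ t, P.net.arcTS t x = 0 := fun h' => h.elim fun t ht => ht.ne' (h' t)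
    rw [P.isProc.init_eq_zero x h0]
    obtain ⟨t, ht⟩ := h
    simp [birth_eq ht]
  · have h0 : ∀ t, P.net.arcTS t x = 0 := by simpa using h
    rw [P.isProc.init_eq_one x h0, birth, dif_neg h]
    simp

theorem birth_eq_succ_iff {x : P.net.S} {i : ℕ} :
    P.birth r x = i + 1 ↔ ∃ t, 0 < P.net.arcTS t x ∧ r t = i := by
  constructor
  · intro h
    by_cases h' : ∃ t, 0 < P.net.arcTS t x
    · obtain ⟨t, ht⟩ := h'
      exact ⟨t, ht, by rw [birth_eq ht] at h; omega⟩
    · rw [birth, dif_neg h'] at h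
      omega
  · rintro ⟨t, ht, rfl⟩
    exact birth_eq ht

theorem birth_le {x : P.net.S} {n : ℕ} (h : ∀ t, 0 < P.net.arcTS t x → r t < n) :
    P.birth r x ≤ n := by
  rcases hb : P.birth r x with _ | i
  · exact Nat.zero_le n
  · obtain ⟨t, ht, rfl⟩ := birth_eq_succ_iff.1 hb
    exact h t ht

theorem death_eq_iff {x : P.net.S} {i : ℕ} :
    P.death r x = i ↔ ∃ t, 0 < P.net.arcST x t ∧ r t = i := by
  constructor
  · intro h
    by_cases h' : ∃ t, 0 < P.net.arcST x t
    · obtain ⟨t, ht⟩ := h'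
      exact ⟨t, ht, by rw [death_eq ht] at h; exact_mod_cast h⟩
    · rw [death, dif_neg h'] at h
      exact absurd h.symm (ENat.natCast_ne_top i)
  · rintro ⟨t, ht, rfl⟩
    exact death_eq ht

variable (P) in
/-- The process `P` can be executed by firing its transitions `t` at the times `r t`, and the
resulting sequence of transitions of `N` is `τ`. -/
structure IsLinearisation (r : P.net.T → ℕ) (τ : ℕ → Option N.T) : Prop where
  inj : Function.Injective r
  le : ∀ x t, 0 < P.net.arcST x t → P.birth r x ≤ r t
  map : ∀ t, τ (r t) = some (P.mapT t)
  exists_of_some : ∀ i u, τ i = some u → ∃ t, r t = i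

namespace IsLinearisation

variable {τ : ℕ → Option N.T}

theorem isRanking (L : P.IsLinearisation r τ) : P.net.IsRanking (P.birth r) r where
  lt _ _ h := by rw [birth_eq h]; exact Nat.lt_succ_self _
  le := L.le

theorem birth_le_death (L : P.IsLinearisation r τ) (x : P.net.S) : P.birth r x ≤ P.death r x := by
  by_cases h : ∃ t, 0 < P.net.arcST x t
  · obtain ⟨t, ht⟩ := h
    rw [death_eq ht]
    exact_mod_cast L.le x t ht
  · rw [death, dif_neg h]
    exact le_top

/-- By injectivity of `r` only one transition can fire at time `i`, and its preplaces over `s` are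
counted by `map_pre`. -/
theorem encard_death_eq (L : P.IsLinearisation r τ) (s : N.S) (i : ℕ) :
    {x : {x // P.mapS x = s} | P.death r x.1 = i}.encard = N.optPre s (τ i) := by
  rcases hi : τ i with _ | u
  · rw [Net.optPre, Nat.cast_zero, Set.encard_eq_zero, Set.eq_empty_iff_forall_notMem]
    intro x hx
    obtain ⟨t, -, rfl⟩ := death_eq_iff.1 hx
    rw [L.map] at hi
    cases hi
  · obtain ⟨t, rfl⟩ := L.exists_of_some i u hi
    obtain rfl : P.mapT t = u := Option.some_injective _ ((L.map t).symm.trans hi)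
    rw [Net.optPre, P.isProc.map_pre, mcard_eq_encard fun x => P.arcST_le_one _ _]
    congr 1
    ext x
    simp only [Set.mem_ofPred_eq]
    rw [death_eq_iff]
    constructor
    · rintro ⟨t', h, ht'⟩
      rwa [← L.inj ht']
    · exact fun h => ⟨t, h, rfl⟩

theorem encard_birth_eq_zero (s : N.S) :
    {x : {x // P.mapS x = s} | (P.birth r x.1 : ℕ∞) = (0 : ℕ)}.encard = N.M₀ s := by
  rw [P.isProc.map_init, mcard_eq_encard fun x => P.M₀_le_one _]
  congr 1
  ext x
  simp only [Set.mem_ofPred_eq]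
  rw [Nat.cast_inj, birth_eq_zero_iff]

theorem encard_birth_eq_succ (L : P.IsLinearisation r τ) (s : N.S) (i : ℕ) :
    {x : {x // P.mapS x = s} | (P.birth r x.1 : ℕ∞) = (i + 1 : ℕ)}.encard =
      N.optPost s (τ i) := by
  rcases hi : τ i with _ | u
  · rw [Net.optPost, Nat.cast_zero, Set.encard_eq_zero, Set.eq_empty_iff_forall_notMem]
    intro x hx
    rw [Set.mem_ofPred_eq, Nat.cast_inj] at hx
    obtain ⟨t, -, rfl⟩ := birth_eq_succ_iff.1 hx
    rw [L.map] at hi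
    cases hi
  · obtain ⟨t, rfl⟩ := L.exists_of_some i u hi
    obtain rfl : P.mapT t = u := Option.some_injective _ ((L.map t).symm.trans hi)
    rw [Net.optPost, P.isProc.map_post, mcard_eq_encard fun x => P.arcTS_le_one _ _]
    congr 1
    ext x
    simp only [Set.mem_ofPred_eq]
    rw [Nat.cast_inj, birth_eq_succ_iff]
    constructor
    · rintro ⟨t', h, ht'⟩
      rwa [← L.inj ht']
    · exact fun h => ⟨t, h, rfl⟩

theorem encard_death_lt (L : P.IsLinearisation r τ) (s : N.S) (i : ℕ) :
    {x : {x // P.mapS x = s} | P.death r x.1 < i}.encard = N.consumed τ i s :=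
  encard_lt_eq_sum (L.encard_death_eq s) i

/-- Births run one step behind the sequence: level `0` is the initial marking and level `i + 1` the
output at time `i`. -/
theorem encard_birth_lt (L : P.IsLinearisation r τ) (s : N.S) (i : ℕ) :
    {x : {x // P.mapS x = s} | (P.birth r x.1 : ℕ∞) < (i + 1 : ℕ)}.encard =
      N.produced τ i s := by
  rw [encard_lt_eq_sum (c := fun i => Nat.casesOn i (N.M₀ s) fun i => N.optPost s (τ i)),
    Finset.sum_range_succ', Net.produced, add_comm]
  · rfl
  · rintro (_ | i)
    · exact encard_birth_eq_zero s
    · exact L.encard_birth_eq_succ s i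

/-- Every place emptied by time `i` was filled by then, so counting over `s` bounds consumption
through time `i` by production before it. -/
theorem valid (L : P.IsLinearisation r τ) : N.Valid τ := by
  intro i t hi s
  have h : {x : {x // P.mapS x = s} | P.death r x.1 < (i + 1 : ℕ)}.encard ≤
      {x : {x // P.mapS x = s} | (P.birth r x.1 : ℕ∞) < (i + 1 : ℕ)}.encard :=
    Set.encard_le_encard fun x hx => (L.birth_le_death x.1).trans_lt hx
  rw [L.encard_death_lt, L.encard_birth_lt, Net.consumed_succ_of_some hi] at h
  exact_mod_cast h

/-- The process may have infinitely many places in all; over one `s`, however, all are born by a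
common time, and production up to that time is finite. -/
theorem finite_fiber [Finite P.net.T] (L : P.IsLinearisation r τ) (s : N.S) :
    Finite {x // P.mapS x = s} := by
  obtain ⟨n, hn⟩ := (Set.finite_range r).bddAbove
  have h := L.encard_birth_lt s (n + 1)
  rw [← Set.finite_univ_iff]
  refine (Set.finite_of_encard_eq_coe h).subset fun x _ => ?_
  simp only [Set.mem_ofPred_eq, Nat.cast_lt]
  exact Nat.lt_succ_of_le (birth_le fun t _ => Nat.lt_succ_of_le (hn ⟨t, rfl⟩))

end IsLinearisation

/-! ### Numbering the places of a process by birth -/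

variable (P) in
/-- The maps `κ s` enumerate the places over `s` in the order of their births. -/
structure IsEnumeration (r : P.net.T → ℕ) (κ : ∀ s, {x // P.mapS x = s} → ℕ) : Prop where
  inj : ∀ s, Function.Injective (κ s)
  lower : ∀ s, IsLowerSet (Set.range (κ s))
  mono : ∀ s x y, κ s x < κ s y → P.birth r x.1 ≤ P.birth r y.1

theorem IsLinearisation.exists_isEnumeration [Finite P.net.T] {τ : ℕ → Option N.T}
    (L : P.IsLinearisation r τ) : ∃ κ, P.IsEnumeration r κ := by
  have h : ∀ s, ∃ κ : {x // P.mapS x = s} → ℕ, Function.Injective κ ∧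
      IsLowerSet (Set.range κ) ∧ ∀ x y, κ x < κ y → P.birth r x.1 ≤ P.birth r y.1 := fun s =>
    have := L.finite_fiber s
    exists_enumeration fun x : {x // P.mapS x = s} => P.birth r x.1
  choose κ h1 h2 h3 using h
  exact ⟨κ, h1, h2, h3⟩

theorem enumeration_congr (κ : ∀ s, {x // P.mapS x = s} → ℕ) {x : P.net.S} {s : N.S}
    (h : P.mapS x = s) : κ s ⟨x, h⟩ = κ (P.mapS x) ⟨x, rfl⟩ := by
  subst h
  rfl

section sorted

variable {τ : ℕ → Option N.T} {κ : ∀ s, {x // P.mapS x = s} → ℕ}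

/-- As `κ` follows the births, the places born by time `i` occupy exactly the first `produced τ i`
numbers. Thus births in `P` agree with births of tokens. -/
theorem IsEnumeration.lt_produced_iff (E : P.IsEnumeration r κ) (L : P.IsLinearisation r τ)
    (x : P.net.S) (i : ℕ) :
    κ (P.mapS x) ⟨x, rfl⟩ < N.produced τ i (P.mapS x) ↔ P.birth r x ≤ i := by
  rw [← lt_iff_of_enumeration (E.inj _) (E.lower _)
    (fun x y h => Nat.cast_le.2 (E.mono _ x y h)) (L.encard_birth_lt _ i)]
  rw [Nat.cast_lt, Nat.lt_succ_iff]

theorem IsEnumeration.exists_eq (E : P.IsEnumeration r κ) (L : P.IsLinearisation r τ)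
    {s : N.S} {k i : ℕ} (h : k < N.produced τ i s) : ∃ x, κ s x = k := by
  rw [← mem_image_iff_of_enumeration (E.inj _) (E.lower _)
    (fun x y h => Nat.cast_le.2 (E.mono _ x y h)) (L.encard_birth_lt _ i)] at h
  exact h.imp fun x hx => hx.2

theorem eq_of_le_one {a b : ℕ} (ha : a ≤ 1) (hb : b ≤ 1) (h : 0 < a ↔ 0 < b) : a = b := by
  omega

/-- A process whose tokens are consumed in the order of their births is the first-in-first-out
process. -/
theorem isomorphic_fifo (L : P.IsLinearisation r τ) (E : P.IsEnumeration r κ)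
    (sorted : ∀ s x y, κ s x < κ s y → P.death r x.1 ≤ P.death r y.1) (hτ : N.Valid τ) :
    P.toNetOver.Isomorphic (fifoProcess τ hτ).toNetOver := by
  -- The same count for deaths, available only because `κ` also sorts these.
  have hD : ∀ (x : P.net.S) (i : ℕ), κ (P.mapS x) ⟨x, rfl⟩ < N.consumed τ i (P.mapS x) ↔
      P.death r x < i := fun x i =>
    (lt_iff_of_enumeration (E.inj _) (E.lower _) (sorted _) (L.encard_death_lt _ i) _).symm
  let fS : P.net.S → N.Token τ := fun x => ⟨(P.mapS x, κ (P.mapS x) ⟨x, rfl⟩), P.birth r x,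
    (E.lt_produced_iff L x _).2 le_rfl⟩
  let fT : P.net.T → N.Occ τ := fun t => ⟨(P.mapT t, r t), L.map t⟩
  have hS : Function.Bijective fS := by
    constructor
    · intro x y hxy
      have h1 : P.mapS x = P.mapS y := congrArg (fun z : N.Token τ => z.1.1) hxy
      have h2 : κ (P.mapS x) ⟨x, rfl⟩ = κ (P.mapS y) ⟨y, rfl⟩ :=
        congrArg (fun z : N.Token τ => z.1.2) hxy
      exact congrArg Subtype.val (E.inj _ ((enumeration_congr κ h1).trans h2))
    · rintro ⟨⟨s, k⟩, i, hi⟩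
      obtain ⟨⟨x, hx⟩, hk⟩ := E.exists_eq L hi
      change P.mapS x = s at hx
      subst hx
      change κ (P.mapS x) ⟨x, rfl⟩ = k at hk
      subst hk
      exact ⟨x, rfl⟩
  have hT : Function.Bijective fT := by
    constructor
    · intro t t' h
      exact L.inj (congrArg (fun z : N.Occ τ => z.1.2) h)
    · rintro ⟨⟨u, i⟩, hi⟩
      obtain ⟨t, rfl⟩ := L.exists_of_some i u hi
      exact ⟨t, Net.Occ.ext' rfl⟩
  refine ⟨⟨Equiv.ofBijective fS hS, Equiv.ofBijective fT hT, fun x => ?_, fun x t => ?_,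
    fun t x => ?_, fun x => rfl, fun t => rfl⟩⟩
  · refine eq_of_le_one (Net.fifo_M₀_le_one (h := hτ) _) (P.M₀_le_one x)
      ((Net.fifo_M₀ (h := hτ) (fS x)).trans ?_)
    rw [← birth_eq_zero_iff (r := r), ← Nat.le_zero, ← E.lt_produced_iff L, Net.produced_zero]
  · refine eq_of_le_one (Net.fifo_le_one (h := hτ) _ _).1 (P.arcST_le_one x t)
      ((Net.fifo_arcST (h := hτ) (fS x) (fT t)).trans ?_)
    -- Both arcs exist precisely when `x` dies at time `r t`: not before `r t`, but before `r t +
    -- 1`.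
    rw [← not_lt]
    simp only [fS, fT]
    rw [hD, hD, not_lt, Nat.cast_add, Nat.cast_one, ENat.lt_add_one_iff (ENat.natCast_ne_top _),
      ← le_antisymm_iff, eq_comm, death_eq_iff]
    constructor
    · rintro ⟨t', h, ht'⟩
      rwa [← L.inj ht']
    · exact fun h => ⟨t, h, rfl⟩
  · refine eq_of_le_one (Net.fifo_le_one (h := hτ) _ _).2 (P.arcTS_le_one t x)
      ((Net.fifo_arcTS (h := hτ) (fS x) (fT t)).trans ?_)
    rw [← not_lt]
    simp only [fS, fT]
    rw [E.lt_produced_iff L, E.lt_produced_iff L, not_le, ← Nat.succ_le_iff, ← le_antisymm_iff,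
      eq_comm, Nat.succ_eq_add_one, birth_eq_succ_iff]
    constructor
    · rintro ⟨t', h, ht'⟩
      rwa [← L.inj ht']
    · exact fun h => ⟨t, h, rfl⟩

end sorted

/-! ### Sorting a process by swaps -/

open Classical in
-- The swap permutes places within a fibre of `mapS`, so all counts survive. Acyclicity and finite
-- pasts are what it could destroy, and the ranking secures them.
theorem isGRProcess_swap {x y : P.net.S} (hxy : P.mapS x = P.mapS y) {b : P.net.S → ℕ}
    (hr : (P.net.swap x y).IsRanking b r) (inj : Function.Injective r) :
    NetOver.IsGRProcess (P.toNetOver.swap x y) where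
  card_pre_le_one := P.isProc.card_pre_le_one
  card_post_le_one z := P.isProc.card_post_le_one (Equiv.swap x y z)
  init_eq_one := P.isProc.init_eq_one
  init_eq_zero := P.isProc.init_eq_zero
  acyclic := hr.acyclic
  finite_past := hr.finite_past inj
  map_init := P.isProc.map_init
  map_pre t s := by
    have hs : ∀ z, P.mapS z = s ↔ P.mapS (Equiv.swap x y z) = s := fun z => by
      rcases eq_or_ne z x with rfl | hx
      · rw [Equiv.swap_apply_left, hxy]
      · rcases eq_or_ne z y with rfl | hy
        · rw [Equiv.swap_apply_right, hxy]
        · rw [Equiv.swap_apply_of_ne_of_ne hx hy]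
    refine (P.isProc.map_pre t s).trans ?_
    exact (mcard_comp_equiv (fun z : {z // P.mapS z = s} => P.net.arcST z.1 t)
      ((Equiv.swap x y).subtypeEquiv hs)).symm
  map_post := P.isProc.map_post

open Classical in
/-- The part of the time before `n` during which `x` has been consumed already. -/
noncomputable def weight (P : GRProcess N) (r : P.net.T → ℕ) (n : ℕ) (x : P.net.S) : ℕ :=
  ((Finset.range n).filter fun i : ℕ => P.death r x ≤ i).card

/-- The death time of `y` itself is counted for `y` but not for `x`. Places never consumed have
weight `0`. -/
theorem weight_lt {n : ℕ} {x y : P.net.S} (hn : ∀ t, r t < n) (h : P.death r y < P.death r x) :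
    P.weight r n x < P.weight r n y := by
  classical
  obtain ⟨i, hi⟩ := ENat.ne_top_iff_exists.1 h.ne_top
  obtain ⟨t, -, rfl⟩ := death_eq_iff.1 hi.symm
  refine Finset.card_lt_card (Finset.ssubset_iff_of_subset ?_ |>.2 ⟨r t, ?_, ?_⟩)
  · intro j hj
    rw [Finset.mem_filter] at hj ⊢
    exact ⟨hj.1, h.le.trans hj.2⟩
  · rw [Finset.mem_filter, Finset.mem_range]
    exact ⟨hn t, hi.ge⟩
  · rw [Finset.mem_filter, hi]
    exact fun h' => h.not_ge h'.2

theorem finite_support_weight [Finite P.net.T] (n : ℕ) :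
    (Function.support (P.weight r n)).Finite := by
  refine (Set.finite_iUnion fun t => P.net.finite_preplaces t).subset fun x hx => ?_
  obtain ⟨i, hi⟩ := Finset.card_pos.1 (Nat.pos_of_ne_zero hx)
  rw [Finset.mem_filter] at hi
  obtain ⟨j, hj⟩ := ENat.ne_top_iff_exists.1 (ne_top_of_le_ne_top (ENat.natCast_ne_top i) hi.2)
  obtain ⟨t, ht, -⟩ := death_eq_iff.1 hj.symm
  exact Set.mem_iUnion.2 ⟨t, ht⟩

open Classical in
/-- An inversion can be removed by a swap. -/
theorem IsLinearisation.exists_swap {τ : ℕ → Option N.T} (L : P.IsLinearisation r τ)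
    {x y : P.net.S} (hxy : P.mapS x = P.mapS y) (hb : P.birth r x ≤ P.birth r y)
    (hd : P.death r y < P.death r x) :
    P.net.Unordered x y ∧ ∃ h : NetOver.IsGRProcess (P.toNetOver.swap x y),
      IsLinearisation ⟨P.toNetOver.swap x y, h⟩ r τ := by
  have hyd := L.birth_le_death y
  have hlt : ∀ t, 0 < P.net.arcST x t → P.birth r y < r t := fun t ht => by
    rw [death_eq ht] at hd
    exact_mod_cast hyd.trans_lt hd
  have hle : ∀ z t, 0 < P.net.arcST (Equiv.swap x y z) t → P.birth r z ≤ r t := by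
    intro z t hzt
    rcases eq_or_ne z x with rfl | hx
    · rw [Equiv.swap_apply_left] at hzt
      exact hb.trans (L.le y t hzt)
    · rcases eq_or_ne z y with rfl | hy
      · rw [Equiv.swap_apply_right] at hzt
        exact (hlt t hzt).le
      · rw [Equiv.swap_apply_of_ne_of_ne hx hy] at hzt
        exact L.le z t hzt
  refine ⟨⟨fun h => ?_, fun h => ?_⟩, isGRProcess_swap hxy ⟨L.isRanking.lt, hle⟩ L.inj,
    L.inj, hle, L.map, L.exists_of_some⟩
  -- A flow path out of a place starts with its consumer. That of `x` fires only after `y` is born,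
  -- and that of `y` not before `x` is born.
  · obtain ⟨t, ht, htb⟩ := L.isRanking.exists_consumer h
    exact absurd (hlt t ht) (not_lt.2 htb.le)
  · obtain ⟨t, ht, htb⟩ := L.isRanking.exists_consumer h
    have := L.le y t ht
    omega

/-- A finite process is swapping equivalent to the first-in-first-out process of any of its
linearisations. -/
theorem IsLinearisation.swapEquiv_fifo [Finite P.net.T] {τ : ℕ → Option N.T}
    (L : P.IsLinearisation r τ) (hτ : N.Valid τ) : SwapEquiv P (fifoProcess τ hτ) := by
  classical
  obtain ⟨κ, E⟩ := L.exists_isEnumeration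
  obtain ⟨n, hn⟩ := (Set.finite_range r).bddAbove
  replace hn : ∀ t, r t < n + 1 := fun t => Nat.lt_succ_of_le (hn ⟨t, rfl⟩)
  -- Induction measure: giving the earlier death to the place with the smaller number decreases it.
  -- It is a finite sum, since only consumed places have weight.
  generalize hm : ∑ᶠ x, κ (P.mapS x) ⟨x, rfl⟩ * P.weight r (n + 1) x = m
  induction m using Nat.strong_induction_on generalizing P with
  | _ m ih =>
    by_cases hs : ∀ s x y, κ s x < κ s y → P.death r x.1 ≤ P.death r y.1
    · exact .single (.inl (isomorphic_fifo L E hs hτ))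
    · push Not at hs
      obtain ⟨s, ⟨x, hx⟩, ⟨y, rfl⟩, hk, hd⟩ := hs
      obtain ⟨hu, h, L'⟩ := L.exists_swap hx (E.mono _ _ _ hk) hd
      let Q : GRProcess N := ⟨P.toNetOver.swap x y, h⟩
      have : Finite Q.net.T := ‹Finite P.net.T›
      have hstep : SwapStep P Q := ⟨x, y, hu, hx, ⟨⟨Equiv.refl _, Equiv.refl _, fun _ => rfl,
        fun _ _ => rfl, fun _ _ => rfl, fun _ => rfl, fun _ => rfl⟩⟩⟩
      -- Swaps leave incoming arcs and hence births alone, so the same `κ` enumerates the places of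
      -- `Q`.
      refine .head (.inr hstep) (ih _ ?_ (P := Q) L' κ ⟨E.inj, E.lower, E.mono⟩ hn rfl)
      rw [← hm]
      rw [enumeration_congr κ hx] at hk
      exact finsum_mul_swap_lt (k := fun x => κ (P.mapS x) ⟨x, rfl⟩)
        (finite_support_weight (n + 1)) hk (weight_lt hn hd)

end GRProcess

/-! ### Firing sequences -/

section

variable {N : Net.{u}}

namespace Net

variable (N) in
/-- The list `σ` of transitions can be fired from the initial marking. -/
def ValidList (σ : List N.T) : Prop := N.Valid fun i => σ[i]?

theorem Valid.consumed_le_produced {τ : ℕ → Option N.T} (h : N.Valid τ) (i : ℕ) (s : N.S) :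
    N.consumed τ i s ≤ N.produced τ i s := by
  induction i with
  | zero => simp [consumed_zero]
  | succ i ih =>
    rcases ht : τ i with _ | t
    · rw [consumed_succ, produced_succ, ht]
      exact ih
    · rw [consumed_succ_of_some ht]
      exact (h i t ht s).trans (produced_mono τ s (Nat.le_succ i))

theorem produced_append (σ ρ : List N.T) {i : ℕ} (hi : i ≤ σ.length) (s : N.S) :
    N.produced (fun i => (σ ++ ρ)[i]?) i s = N.produced (fun i => σ[i]?) i s :=
  produced_congr fun _ hj => List.getElem?_append_left (hj.trans_le hi)

theorem consumed_append (σ ρ : List N.T) {i : ℕ} (hi : i ≤ σ.length) (s : N.S) :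
    N.consumed (fun i => (σ ++ ρ)[i]?) i s = N.consumed (fun i => σ[i]?) i s :=
  consumed_congr fun _ hj => List.getElem?_append_left (hj.trans_le hi)

theorem validList_nil : N.ValidList [] := fun i t h => by simp at h

theorem ValidList.of_append {σ ρ : List N.T} (h : N.ValidList (σ ++ ρ)) : N.ValidList σ := by
  intro i t ht s
  have hi : i < σ.length := (List.getElem?_eq_some_iff.1 ht).1
  rw [← produced_append σ ρ hi.le, ← consumed_append σ ρ hi.le]
  exact h i t ((List.getElem?_append_left hi).trans ht) s

theorem validList_concat_iff {σ : List N.T} {t : N.T} : N.ValidList (σ ++ [t]) ↔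
    N.ValidList σ ∧ ∀ s, N.consumed (fun i => σ[i]?) σ.length s + N.arcST s t ≤
      N.produced (fun i => σ[i]?) σ.length s := by
  constructor
  · intro h
    refine ⟨h.of_append, fun s => ?_⟩
    rw [← produced_append σ [t] le_rfl, ← consumed_append σ [t] le_rfl]
    exact h σ.length t (by simp) s
  · rintro ⟨h, ht⟩ i u hu s
    have hi : i < (σ ++ [t]).length := (List.getElem?_eq_some_iff.1 hu).1
    rw [List.length_append, List.length_singleton, Nat.lt_succ_iff] at hi
    rw [produced_append σ [t] hi, consumed_append σ [t] hi]
    rcases hi.lt_or_eq with hi | rfl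
    · exact h i u ((List.getElem?_append_left hi).symm.trans hu) s
    · obtain rfl : t = u := by simpa using hu
      exact ht s

variable (N) in
/-- The marking reached by firing `σ`. -/
def markingAfter (σ : List N.T) (s : N.S) : ℕ :=
  N.produced (fun i => σ[i]?) σ.length s - N.consumed (fun i => σ[i]?) σ.length s

theorem Fires.append {M₁ M₂ M₃ : N.S → ℕ} {σ ρ : List N.T} (h : N.Fires M₁ σ M₂)
    (h' : N.Fires M₂ ρ M₃) : N.Fires M₁ (σ ++ ρ) M₃ := by
  induction σ generalizing M₁ with
  | nil =>
    obtain rfl : M₁ = M₂ := h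
    exact h'
  | cons t σ ih =>
    obtain ⟨M, h1, h2⟩ := h
    exact ⟨M, h1, ih h2⟩

/-- Translates the cumulative counts into markings, as needed for reachability; validity keeps the
truncated subtractions exact. -/
theorem ValidList.fires {σ : List N.T} (h : N.ValidList σ) :
    N.Fires N.M₀ σ (N.markingAfter σ) := by
  induction σ using List.reverseRecOn with
  | nil =>
    change N.M₀ = _
    funext s
    simp [markingAfter, produced_zero, consumed_zero]
  | append_singleton σ t ih =>
    obtain ⟨h1, h2⟩ := validList_concat_iff.1 h
    refine (ih h1).append ⟨_, ⟨by simp, fun s => ?_, rfl⟩, ?_⟩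
    · have := h2 s
      simp only [pre, Multiset.map_singleton, Multiset.sum_singleton, markingAfter]
      omega
    · change _ = _
      funext s
      have := h2 s
      have hσ : (σ ++ [t])[σ.length]? = some t := by simp
      simp only [pre, post, Pi.add_apply, Pi.sub_apply, Multiset.map_singleton,
        Multiset.sum_singleton, markingAfter, List.length_append, List.length_singleton]
      rw [produced_succ_of_some (t := t) hσ, consumed_succ_of_some (t := t) hσ,
        produced_append _ _ le_rfl, consumed_append _ _ le_rfl]
      omega

/-! ### Concurrency and exchange of adjacent transitions -/

variable (N) in
/-- After firing `σ`, the transitions `t` and `u` can fire in one step. -/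
def Concurrent (σ : List N.T) (t u : N.T) : Prop :=
  ∀ s, N.consumed (fun i => σ[i]?) σ.length s + N.arcST s t + N.arcST s u ≤
    N.produced (fun i => σ[i]?) σ.length s

theorem Concurrent.symm {σ : List N.T} {t u : N.T} (h : N.Concurrent σ t u) :
    N.Concurrent σ u t := fun s => by
  have := h s
  omega

theorem Concurrent.validList {σ : List N.T} {t u : N.T} (h : N.Concurrent σ t u)
    (hσ : N.ValidList σ) : N.ValidList (σ ++ [t, u]) := by
  have ht : N.ValidList (σ ++ [t]) := validList_concat_iff.2 ⟨hσ, fun s => by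
    have := h s
    omega⟩
  rw [show σ ++ [t, u] = σ ++ [t] ++ [u] by simp, validList_concat_iff]
  refine ⟨ht, fun s => ?_⟩
  have h1 := h s
  have h2 : (σ ++ [t])[σ.length]? = some t := by simp
  rw [List.length_append, List.length_singleton, produced_succ_of_some (t := t) h2,
    consumed_succ_of_some (t := t) h2, produced_append _ _ le_rfl, consumed_append _ _ le_rfl]
  omega

/-- As `t ≠ u`, the restrictions of `{t, u}` are the singletons, both enabled; without a conflict
the pair itself must be a step. -/
theorem BinaryConflictFree.concurrent (hN : N.BinaryConflictFree) {σ : List N.T} {t u : N.T}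
    (htu : t ≠ u) (ht : N.ValidList (σ ++ [t])) (hu : N.ValidList (σ ++ [u])) :
    N.Concurrent σ t u := by
  classical
  have hσ := ht.of_append
  have key : ∀ v, N.ValidList (σ ++ [v]) → N.CanStep (N.markingAfter σ) {v} := fun v hv =>
    ⟨_, by simp, fun s => by
      have := (validList_concat_iff.1 hv).2 s
      simp only [pre, Multiset.map_singleton, Multiset.sum_singleton, markingAfter]
      omega, rfl⟩
  have hstep : N.CanStep (N.markingAfter σ) {t, u} := by
    by_contra hc
    refine hN {t, u} _ (by simp) ⟨σ, hσ.fires⟩ ⟨by simp, fun v hv => ?_, hc⟩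
    rcases Multiset.mem_cons.1 hv with rfl | hv
    · convert key v ht
      rw [Multiset.insert_eq_cons, Multiset.filter_cons_of_pos (p := fun w => w = v) _ rfl,
        Multiset.filter_singleton, if_neg htu.symm]
      rfl
    · obtain rfl := Multiset.mem_singleton.1 hv
      convert key v hu
      rw [Multiset.insert_eq_cons, Multiset.filter_cons_of_neg (p := fun w => w = v) _ htu,
        Multiset.filter_singleton, if_pos rfl]
  intro s
  obtain ⟨_, -, hle, -⟩ := hstep
  have h1 := hle s
  have h2 := Valid.consumed_le_produced hσ σ.length s
  simp only [pre, markingAfter, Multiset.insert_eq_cons, Multiset.map_cons, Multiset.sum_cons,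
    Multiset.map_singleton, Multiset.sum_singleton] at h1
  omega

variable (N) in
/-- Exchanging two adjacent concurrent transitions of a firing sequence. -/
inductive Adjacent : List N.T → List N.T → Prop
  | mk (σ ρ : List N.T) (t u : N.T) (h : N.Concurrent σ t u) :
      Adjacent (σ ++ t :: u :: ρ) (σ ++ u :: t :: ρ)

variable (N) in
/-- The equivalence of firing sequences generated by exchanging adjacent concurrent
transitions. -/
def SeqEquiv : List N.T → List N.T → Prop := Relation.ReflTransGen N.Adjacent

theorem SeqEquiv.symm {σ ρ : List N.T} (h : N.SeqEquiv σ ρ) : N.SeqEquiv ρ σ := by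
  unfold SeqEquiv at h ⊢
  induction h with
  | refl => exact .refl
  | tail _ h ih =>
    obtain ⟨σ, ρ, t, u, h⟩ := h
    exact .head ⟨σ, ρ, u, t, h.symm⟩ ih

theorem SeqEquiv.append_right {σ ρ : List N.T} (h : N.SeqEquiv σ ρ) (χ : List N.T) :
    N.SeqEquiv (σ ++ χ) (ρ ++ χ) := by
  refine Relation.ReflTransGen.lift (· ++ χ) ?_ _ _ h
  rintro _ _ ⟨σ, ρ, t, u, h⟩
  simpa [Function.onFun] using Adjacent.mk σ (ρ ++ χ) t u h

theorem getElem?_swap {α : Type*} (σ ρ : List α) (t u : α) (i : ℕ) :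
    (σ ++ u :: t :: ρ)[Equiv.swap σ.length (σ.length + 1) i]? = (σ ++ t :: u :: ρ)[i]? := by
  rcases lt_trichotomy i σ.length with h | rfl | h
  · rw [Equiv.swap_apply_of_ne_of_ne (by omega) (by omega), List.getElem?_append_left h,
      List.getElem?_append_left h]
  · rw [Equiv.swap_apply_left]
    simp
  · obtain ⟨d, rfl⟩ := Nat.exists_eq_add_of_lt h
    rcases d with _ | d
    · rw [Nat.add_zero, Equiv.swap_apply_right]
      simp
    · rw [Equiv.swap_apply_of_ne_of_ne (by omega) (by omega),
        List.getElem?_append_right (by omega), List.getElem?_append_right (by omega),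
        show σ.length + (d + 1) + 1 - σ.length = d + 1 + 1 by omega]
      rfl

end Net

/-! ### Swapping classes of firing sequences -/

open Net

/-- The finite process of a firing sequence. -/
noncomputable def listProcess (σ : List N.T) (h : N.ValidList σ) : FinProcess N :=
  ⟨fifoProcess (fun i => σ[i]?) h, Finite.of_injective
    (fun y : N.Occ fun i => σ[i]? => (⟨y.1.2, (List.getElem?_eq_some_iff.1 y.2).1⟩ :
      Fin σ.length)) fun _ _ hy => Occ.ext' (congrArg Fin.val hy)⟩

theorem FinBD.mk_eq_listProcess {P : FinProcess N} {r : P.1.net.T → ℕ} {σ : List N.T}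
    (L : P.1.IsLinearisation r fun i => σ[i]?) :
    FinBD.mk P = FinBD.mk (listProcess σ L.valid) :=
  have : Finite P.1.net.T := P.2
  Quotient.sound (L.swapEquiv_fifo L.valid)

/-- Exchanging adjacent concurrent transitions gives another linearisation of the same
process. -/
theorem Net.Adjacent.mk_eq {σ ρ : List N.T} (h : N.Adjacent σ ρ) (hσ : N.ValidList σ) :
    ∃ hρ : N.ValidList ρ, FinBD.mk (listProcess σ hσ) = FinBD.mk (listProcess ρ hρ) := by
  obtain ⟨σ, ρ, t, u, h⟩ := h
  set n := σ.length with hn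
  set τ : ℕ → Option N.T := fun i => (σ ++ t :: u :: ρ)[i]? with hτ
  -- The process stays that of the first list; only the firing times `n` and `n + 1` are exchanged.
  let r : N.Occ τ → ℕ := fun y => Equiv.swap n (n + 1) y.1.2
  have ht : τ n = some t := by simp [hτ, hn]
  have hu : τ (n + 1) = some u := by simp [hτ, hn]
  have L : (fifoProcess τ hσ).IsLinearisation r fun i => (σ ++ u :: t :: ρ)[i]? :=
    { inj := fun y z hyz => Occ.ext' ((Equiv.swap n (n + 1)).injective hyz)
      le := fun x y hxy => GRProcess.birth_le fun z hzx => by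
        have hlt : z.1.2 < y.1.2 :=
          ((fifo_isRanking hσ).lt z x hzx).trans_le ((fifo_isRanking hσ).le x y hxy)
        -- The only causality the exchange could break. The tokens taken by `u` at time `n + 1` are
        -- numbered below `produced` at time `n`, by concurrency, so none of them comes from `t`.
        have hne : ¬ (z.1.2 = n ∧ y.1.2 = n + 1) := by
          rintro ⟨hz, hy⟩
          have h1 := (fifo_arcST (h := hσ) x y).1 hxy
          have h2 := (fifo_arcTS (h := hσ) x z).1 hzx
          have h3 := h x.1.1
          rw [hy, consumed_succ_of_some hu, consumed_succ_of_some ht,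
            consumed_append _ _ le_rfl] at h1
          rw [hz, produced_append _ _ le_rfl] at h2
          omega
        simp only [r, Equiv.swap_apply_def]
        split_ifs <;> omega
      map := fun y => (getElem?_swap σ ρ t u y.1.2).trans y.2
      exists_of_some := fun i v hv => by
        refine ⟨⟨(v, Equiv.swap n (n + 1) i), ?_⟩, Equiv.swap_apply_self _ _ _⟩
        have h' := getElem?_swap σ ρ t u (Equiv.swap n (n + 1) i)
        rw [← hn, Equiv.swap_apply_self] at h'
        exact h'.symm.trans hv }
  exact ⟨L.valid, FinBD.mk_eq_listProcess (P := listProcess _ hσ) L⟩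

theorem Net.SeqEquiv.mk_eq {σ ρ : List N.T} (h : N.SeqEquiv σ ρ) (hσ : N.ValidList σ) :
    ∃ hρ : N.ValidList ρ, FinBD.mk (listProcess σ hσ) = FinBD.mk (listProcess ρ hρ) := by
  unfold SeqEquiv at h
  induction h with
  | refl => exact ⟨hσ, rfl⟩
  | tail _ h ih =>
    obtain ⟨h1, e1⟩ := ih
    obtain ⟨h2, e2⟩ := h.mk_eq h1
    exact ⟨h2, e1.trans e2⟩

theorem listProcess_isPrefix {σ ρ : List N.T} (h : N.ValidList (σ ++ ρ)) :
    FinBD.IsPrefix (FinBD.mk (listProcess σ h.of_append)) (FinBD.mk (listProcess _ h)) :=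
  ⟨listProcess σ h.of_append, listProcess _ h, rfl, fifoProcess_isPrefix _ _ σ.length
    (fun _ hi => (List.getElem?_append_left hi).symm)
    fun _ hi => List.getElem?_eq_none hi, rfl⟩

/-- Every finite process has a linearisation. -/
theorem FinBD.exists_firingSequence (A : FinBD N) :
    ∃ (σ : List N.T) (h : N.ValidList σ), A = FinBD.mk (listProcess σ h) := by
  obtain ⟨P, rfl⟩ := Quotient.exists_rep A
  have : Finite P.1.net.T := P.2
  let _ := Fintype.ofFinite P.1.net.T
  -- Acyclicity makes causality a partial order; a linear extension of it supplies the firing times.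
  let _ : PartialOrder P.1.net.T :=
    { le := fun t t' => Relation.ReflTransGen P.1.net.Flow (.inr t) (.inr t')
      le_refl := fun _ => .refl
      le_trans := fun _ _ _ => .trans
      le_antisymm := fun t t' h h' => by
        rcases Relation.reflTransGen_iff_eq_or_transGen.1 h with e | h
        · exact (Sum.inr_injective e).symm
        · exact absurd (h.trans_left h') (P.1.isProc.acyclic _) }
  let _ : Fintype (LinearExtension P.1.net.T) := inferInstanceAs (Fintype P.1.net.T)
  let e := (Fintype.orderIsoFinOfCardEq (LinearExtension P.1.net.T) rfl).symm
  let r : P.1.net.T → ℕ := fun t => e (toLinearExtension t)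
  let σ : List N.T := List.ofFn fun i => P.1.mapT (e.symm i)
  have L : P.1.IsLinearisation r fun i => σ[i]? :=
    { inj := fun t t' h => e.injective (Fin.ext h)
      le := fun x t hxt => GRProcess.birth_le fun t' hx => by
        have hf : P.1.net.FlowPlus (.inr t') (.inr t) :=
          .tail (.single (show P.1.net.Flow (.inr t') (.inl x) from hx))
            (show P.1.net.Flow (.inl x) (.inr t) from hxt)
        have hle : t' ≤ t := hf.to_reflTransGen
        have hne : t' ≠ t := by
          rintro rfl
          exact P.1.isProc.acyclic _ hf
        have := (toLinearExtension.monotone hle).lt_of_ne hne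
        exact e.strictMono this
      map := fun t => by
        simp only [σ, r]
        rw [List.getElem?_ofFn, dif_pos (Fin.is_lt _)]
        simp
        rfl
      exists_of_some := fun i v hv => by
        have hi := (List.getElem?_eq_some_iff.1 hv).1
        rw [List.length_ofFn] at hi
        exact ⟨e.symm ⟨i, hi⟩, congrArg Fin.val (e.apply_symm_apply ⟨i, hi⟩)⟩ }
  exact ⟨σ, L.valid, FinBD.mk_eq_listProcess L⟩

/-! ### Confluence -/

/-- An enabled `t` stays enabled while other transitions fire. If `t` occurs in `ρ`, its first
occurrence moves to the front and `χ` is empty; otherwise `χ = [t]` is appended and moved there. -/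
theorem Net.BinaryConflictFree.strip (hN : N.BinaryConflictFree) (ρ α : List N.T) (t : N.T)
    (ht : N.ValidList (α ++ [t])) (hρ : N.ValidList (α ++ ρ)) :
    ∃ χ ρ', N.ValidList (α ++ ρ ++ χ) ∧ N.SeqEquiv (α ++ ρ ++ χ) (α ++ [t] ++ ρ') := by
  induction ρ generalizing α with
  | nil => exact ⟨[t], [], by simpa using ht, by simpa using .refl⟩
  | cons u ρ ih =>
    by_cases htu : t = u
    · subst htu
      exact ⟨[], ρ, by simpa using hρ, by simpa using .refl⟩
    · have hu : N.ValidList (α ++ [u]) := by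
        rw [show α ++ u :: ρ = α ++ [u] ++ ρ by simp] at hρ
        exact hρ.of_append
      have hc := hN.concurrent htu ht hu
      obtain ⟨χ, ρ', h1, h2⟩ := ih (α ++ [u])
        (by simpa using hc.symm.validList ht.of_append) (by simpa using hρ)
      refine ⟨χ, u :: ρ', by simpa using h1, ?_⟩
      have h3 : N.SeqEquiv (α ++ u :: ρ ++ χ) (α ++ u :: t :: ρ') := by simpa using h2
      refine .tail h3 ?_
      simpa using Adjacent.mk α ρ' u t hc.symm

/-- Tiling: the letters of `σ` are stripped off one at a time, each against what is left of `ρ`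
after the previous one. -/
theorem Net.BinaryConflictFree.confluent (hN : N.BinaryConflictFree) (σ α ρ : List N.T)
    (hσ : N.ValidList (α ++ σ)) (hρ : N.ValidList (α ++ ρ)) :
    ∃ χ ξ, N.ValidList (α ++ σ ++ χ) ∧ N.SeqEquiv (α ++ σ ++ χ) (α ++ ρ ++ ξ) := by
  induction σ generalizing α ρ with
  | nil => exact ⟨ρ, [], by simpa using hρ, by simpa using .refl⟩
  | cons t σ ih =>
    have hσ' : N.ValidList (α ++ [t] ++ σ) := by simpa using hσ
    obtain ⟨χ₀, ρ', h1, h2⟩ := hN.strip ρ α t hσ'.of_append hρ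
    obtain ⟨h3, -⟩ := h2.mk_eq h1
    obtain ⟨χ, ξ, h4, h5⟩ := ih (α ++ [t]) ρ' hσ' h3
    refine ⟨χ, χ₀ ++ ξ, by simpa using h4, ?_⟩
    have h6 : N.SeqEquiv _ _ := h5.trans (h2.symm.append_right ξ)
    simpa using h6

/-- Any firing sequence embeds, up to equivalence, in some extension of any other one. -/
theorem Net.BinaryConflictFree.exists_extension (hN : N.BinaryConflictFree) {σ ρ : List N.T}
    (hσ : N.ValidList σ) (hρ : N.ValidList ρ) :
    ∃ (ξ : List N.T) (h : N.ValidList (ρ ++ ξ)),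
      FinBD.IsPrefix (FinBD.mk (listProcess σ hσ)) (FinBD.mk (listProcess (ρ ++ ξ) h)) := by
  obtain ⟨χ, ξ, h1, h2⟩ := hN.confluent σ [] ρ hσ hρ
  obtain ⟨h3, h4⟩ := h2.mk_eq h1
  exact ⟨ξ, h3, h4 ▸ listProcess_isPrefix h1⟩

theorem Net.BinaryConflictFree.isBDRun_univ (hN : N.BinaryConflictFree) :
    IsBDRun (Set.univ : Set (FinBD N)) where
  nonempty := ⟨FinBD.mk (listProcess [] validList_nil), trivial⟩
  prefix_closed _ _ _ _ := trivial
  directed A _ B _ := by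
    obtain ⟨σ, hσ, rfl⟩ := A.exists_firingSequence
    obtain ⟨ρ, hρ, rfl⟩ := B.exists_firingSequence
    obtain ⟨ξ, h, h'⟩ := hN.exists_extension hσ hρ
    exact ⟨_, trivial, h', listProcess_isPrefix h⟩

/-! ### A universal firing sequence -/

/-- A firing sequence, possibly infinite, that extends each list of a chain. -/
theorem exists_limit {α : Type*} (ρ : ℕ → List α) (h : ∀ n, ρ n <+: ρ (n + 1)) :
    ∃ τ : ℕ → Option α, (∀ n, ∀ i < (ρ n).length, τ i = (ρ n)[i]?) ∧
      ∀ i a, τ i = some a → ∃ n, i < (ρ n).length := by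
  classical
  have hmono : ∀ m n, m ≤ n → ρ m <+: ρ n := fun m n hmn =>
    Nat.le_induction (List.prefix_refl _) (fun n _ ih => ih.trans (h n)) n hmn
  have key : ∀ m n i, i < (ρ m).length → i < (ρ n).length → (ρ m)[i]? = (ρ n)[i]? := by
    intro m n i hm hn
    rcases le_total m n with hmn | hmn
    · obtain ⟨χ, hχ⟩ := hmono m n hmn
      rw [← hχ, List.getElem?_append_left hm]
    · obtain ⟨χ, hχ⟩ := hmono n m hmn
      rw [← hχ, List.getElem?_append_left hn]
  -- All lists long enough agree at `i`, so any choice will do; if the chain stops growing, only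
  -- pauses follow.
  refine ⟨fun i => if h : ∃ n, i < (ρ n).length then (ρ h.choose)[i]? else none,
    fun n i hi => ?_, fun i a ha => ?_⟩
  · have h' : ∃ n, i < (ρ n).length := ⟨n, hi⟩
    refine (dif_pos h').trans ?_
    exact key _ _ _ h'.choose_spec hi
  · by_contra h'
    cases (dif_neg h').symm.trans ha

/-- A countable binary-conflict-free net has a process that subsumes all finite processes. -/
theorem Net.BinaryConflictFree.exists_bdRun_eq_univ (hN : N.BinaryConflictFree)
    [Countable N.T] : ∃ P : GRProcess N, P.bdRun = Set.univ := by
  have : Nonempty {σ : List N.T // N.ValidList σ} := ⟨[], validList_nil⟩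
  obtain ⟨f, hf⟩ := exists_surjective_nat {σ : List N.T // N.ValidList σ}
  choose ξ h h' using fun σ ρ : {σ : List N.T // N.ValidList σ} =>
    hN.exists_extension σ.2 ρ.2
  -- Stage `n + 1` extends stage `n` so that the class of the `n`-th firing sequence lies below its
  -- class.
  let g : ℕ → {σ : List N.T // N.ValidList σ} := fun n =>
    Nat.rec ⟨[], validList_nil⟩ (fun n ρ => ⟨ρ.1 ++ ξ (f n) ρ, h (f n) ρ⟩) n
  obtain ⟨τ, h1, h2⟩ := exists_limit (fun n => (g n).1) fun n => List.prefix_append _ _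
  -- Validity at time `i` involves only the sequence up to `i`, which lies in some stage `g n`.
  have hτ : N.Valid τ := fun i t ht s => by
    obtain ⟨n, hn⟩ := h2 i t ht
    rw [produced_congr (τ' := τ) (τ := fun i => (g n).1[i]?) fun j hj => h1 n j (hj.trans hn),
      consumed_congr (τ' := τ) (τ := fun i => (g n).1[i]?) fun j hj => h1 n j (hj.trans hn)]
    exact (g n).2 i t ((h1 n i hn).symm.trans ht) s
  refine ⟨fifoProcess τ hτ, Set.eq_univ_of_forall fun A => ?_⟩
  obtain ⟨σ, hσ, rfl⟩ := A.exists_firingSequence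
  obtain ⟨n, hn⟩ := hf ⟨σ, hσ⟩
  obtain rfl : (f n).1 = σ := congrArg Subtype.val hn
  refine ⟨listProcess _ (g (n + 1)).2, fifoProcess_isPrefix _ _ (g (n + 1)).1.length
    (fun i hi => (h1 (n + 1) i hi).symm) fun i hi => List.getElem?_eq_none hi, ?_⟩
  exact h' (f n) (g n)

/-! ### Run-maximality -/

/-- The full set is a BD-run, so no proper subset of it is maximal. -/
theorem Net.BinaryConflictFree.runMaximal_iff (hN : N.BinaryConflictFree) (B : BDProcess N) :
    B.RunMaximal ↔ B.bdRun = Set.univ :=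
  ⟨fun h => Set.univ_subset_iff.1 (h.2 hN.isBDRun_univ (Set.subset_univ _)), fun h => by
    rw [BDProcess.RunMaximal, h]
    exact ⟨hN.isBDRun_univ, fun _ _ _ => Set.subset_univ _⟩⟩

theorem BDProcess.bdRun_injective : Function.Injective (BDProcess.bdRun (N := N)) := by
  intro B B'
  induction B using Quotient.inductionOn
  induction B' using Quotient.inductionOn
  exact fun h => Quotient.sound h

end

theorem mainTheorem7 (N : Net.{u}) (hN : N.BinaryConflictFree) :
    (∀ B B' : BDProcess N, B.RunMaximal → B'.RunMaximal → B = B') ∧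
      (N.IsCountable → ∃! B : BDProcess N, B.RunMaximal) := by
  have unique : ∀ B B' : BDProcess N, B.RunMaximal → B'.RunMaximal → B = B' :=
    fun B B' h h' => BDProcess.bdRun_injective
      (((hN.runMaximal_iff B).1 h).trans ((hN.runMaximal_iff B').1 h').symm)
  refine ⟨unique, fun hc => ?_⟩
  have := hc.2
  obtain ⟨P, hP⟩ := hN.exists_bdRun_eq_univ
  have hB : BDProcess.RunMaximal (Quotient.mk (bdSetoid N) P) := (hN.runMaximal_iff _).2 hP
  exact ⟨_, hB, fun B h => unique B _ h hB⟩
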